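/- Let $n\ge 1$ and let $m=2n$ or $m=2n-1$. If $m=2n$ put $r=n$, $s=0$; if $m=2n-1$ put $r=n-1$, $s=1$ (so $m=2r+s$). *The Poisson superalgebra.* Let $\Lambda(m)$ be the Grassmann superalgebra over $\mathbb C$ with odd generators $\xi_1,\dots,\xi_r,\eta_1,\dots,\eta_r$ and, if $s=1$, one more odd generator $\theta$. The Lie superalgebra $\mathfrak{po}(0|m)$ is the superspace $\Lambda(m)$ with the bracket $$\{f,g\}=(-1)^{p(f)}\Big(\sum_{i=1}^r\Big(\frac{\partial f}{\partial\xi_i}\frac{\partial g}{\partial\eta_i}+\frac{\partial f}{\partial\eta_i}\frac{\partial g}{\partial\xi_i}\Big)+\frac{\partial f}{\partial\theta}\frac{\partial g}{\partial\theta}\Big),$$ where the last term is present only if $s=1$. *The Clifford superalgebra.* Let $e\ge1$ be an integer, $K=\mathbb C((t))$ and $\hbar=t^e\in K$ (for $e=1$ simply $K=\mathbb C((\hbar))$; for $e=2$ the field $K$ contains $\sqrt\hbar$). Let $\mathrm{Cliff}_\hbar$ be the superalgebra over $K$ with odd generators $\hat\xi_i,\hat\eta_i$ $(1\le i\le r)$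 and, if $s=1$, $\hat\theta$, with $\hat\xi_i\hat\eta_j+\hat\eta_j\hat\xi_i=\delta_{ij}\hbar$, $\hat\theta^2=\tfrac12\hbar$, all other pairs of distinct generators anticommuting and $\hat\xi_i^2=\hat\eta_i^2=0$. With the supercommutator $[x,y]=xy-(-1)^{p(x)p(y)}yx$ it is a Lie superalgebra over $K$. (After adjoining $\sqrt\hbar$ if $m$ is odd, it is isomorphic to $\mathfrak{gl}(2^{n-1}|2^{n-1})$ for $m=2n$ and to $\mathfrak q(2^{n-1})$ for $m=2n-1$.) *Quantization.* The monomials $\xi_I\eta_J\theta^\varepsilon$ form a basis of $\Lambda(m)$ over $\mathbb C$, and the monomials $\hat\xi_I\hat\eta_J\hat\theta^\varepsilon$ form a basis of $\mathrm{Cliff}_\hbar$ over $K$, where $I,J$ are increasingly ordered subsets of $\{1,\dots,r\}$ and $0\le\varepsilon\le s$. Let $Q$ be the linear map with $Q(\xi_I\eta_J\theta^\varepsilon)=\hat\xi_I\hat\eta_J\hat\theta^\varepsilon$. *Invariant polynomials.* The algebra of polynomials on a finite-dimensional superspace $V$ is the supersymmetric algebra $S(V^*)$ of the dual superspace. A polynomial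 on a Lie superalgebra $\mathfrak g$ is invariant if it is annihilated by the coadjoint action of $\mathfrak g$, extended to $S(\mathfrak g^*)$ by superderivations. Write $Q$ also for the $\mathbb C$-algebra homomorphism $S(\Lambda(m)^*)\to S(\mathrm{Cliff}_\hbar^*)$ that sends the coordinate dual to $\xi_I\eta_J\theta^\varepsilon$ to the coordinate dual to $\hat\xi_I\hat\eta_J\hat\theta^\varepsilon$. Every polynomial $F$ on $\mathrm{Cliff}_\hbar$ can be expanded as $F=\sum_{k\ge k_0}F_k\,t^k=\sum_{k\ge k_0}F_k\,\hbar^{k/e}$, where $k_0\in\mathbb Z$ and the $F_k$ lie in the image of $Q$, that is, are polynomials with complex coefficients in the coordinates dual to $\hat\xi_I\hat\eta_J\hat\theta^\varepsilon$. **Lemma 5.** Let $F$ be an invariant polynomial on $\mathrm{Cliff}_\hbar$ considered as a Lie superalgebra, and let $F=\sum_{k\ge k_0}F_k\,\hbar^{k/e}$ be its expansion. If $P\in S(\Lambda(m)^*)$ is a polynomial on $\mathfrak{po}(0|m)$ such that $Q(P)=F_{k_0}$, then $P$ is an invariant polynomial on $\mathfrak{po}(0|m)$. In words, the lowest $\hbar$-components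 of the invariant polynomials on the quantized algebra are invariant polynomials on the Poisson superalgebra. -/

import Mathlib

noncomputable section

/-! ## Superspaces and supersymmetric polynomials

A superspace over `R` is a module `V` with a `ZMod 2`-grading `𝒜`. -/

section Super

variable {R V : Type*} [CommRing R] [AddCommGroup V] [Module R V]

/-- The projection of a superspace onto its component of parity `j`. -/
def parityProj (𝒜 : ZMod 2 → Submodule R V) [DirectSum.Decomposition 𝒜] (j : ZMod 2) :
    V →ₗ[R] V :=
  (𝒜 j).subtype ∘ₗ DirectSum.component R (ZMod 2) (fun k => 𝒜 k) j ∘ₗ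
    (DirectSum.decomposeLinearEquiv 𝒜).toLinearMap

/-- The operator equal to `(-1) ^ (i * j)` on the component of parity `j`. -/
def parityTwist (𝒜 : ZMod 2 → Submodule R V) [DirectSum.Decomposition 𝒜] (i : ZMod 2) :
    V →ₗ[R] V :=
  ∑ j : ZMod 2, ((-1 : ℤˣ) ^ (i * j)) • parityProj 𝒜 j

theorem parityProj_of_mem (𝒜 : ZMod 2 → Submodule R V) [DirectSum.Decomposition 𝒜]
    {j : ZMod 2} {v : V} (hv : v ∈ 𝒜 j) (k : ZMod 2) :
    parityProj 𝒜 k v = if k = j then v else 0 := by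
  change ((DirectSum.decompose 𝒜 v k : 𝒜 k) : V) = _
  split_ifs with h
  · subst h
    exact DirectSum.decompose_of_mem_same 𝒜 hv
  · exact DirectSum.decompose_of_mem_ne 𝒜 hv (Ne.symm h)

theorem parityTwist_of_mem (𝒜 : ZMod 2 → Submodule R V) [DirectSum.Decomposition 𝒜]
    (i : ZMod 2) {j : ZMod 2} {v : V} (hv : v ∈ 𝒜 j) :
    parityTwist 𝒜 i v = ((-1 : ℤˣ) ^ (i * j)) • v := by
  simp [parityTwist, LinearMap.sum_apply, LinearMap.smul_apply, parityProj_of_mem 𝒜 hv]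

/-- The component of parity `i` of the dual superspace: the linear functionals that vanish on
all vectors of parity different from `i`. -/
def dualPart (𝒜 : ZMod 2 → Submodule R V) (i : ZMod 2) : Submodule R (Module.Dual R V) :=
  (𝒜 (i + 1)).dualAnnihilator

/-- The relations `α β = (-1) ^ (p(α) p(β)) β α` between coordinate functions. -/
inductive SuperCommRel (𝒜 : ZMod 2 → Submodule R V) :
    TensorAlgebra R (Module.Dual R V) → TensorAlgebra R (Module.Dual R V) → Prop
  | swap {i j : ZMod 2} {α β : Module.Dual R V} (hα : α ∈ dualPart 𝒜 i)
      (hβ : β ∈ dualPart 𝒜 j) :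
      SuperCommRel 𝒜 (TensorAlgebra.ι R α * TensorAlgebra.ι R β)
        (((-1 : ℤˣ) ^ (i * j)) • (TensorAlgebra.ι R β * TensorAlgebra.ι R α))

/-- Polynomials on the superspace `V`: the symmetric algebra, in the super sense, of the dual
superspace `V*`. -/
def SuperPoly (𝒜 : ZMod 2 → Submodule R V) : Type _ := RingQuot (SuperCommRel 𝒜)

instance (𝒜 : ZMod 2 → Submodule R V) : Ring (SuperPoly 𝒜) :=
  inferInstanceAs (Ring (RingQuot (SuperCommRel 𝒜)))

instance {S : Type*} [CommRing S] [Algebra S R] (𝒜 : ZMod 2 → Submodule R V) :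
    Algebra S (SuperPoly 𝒜) :=
  inferInstanceAs (Algebra S (RingQuot (SuperCommRel 𝒜)))

instance {S : Type*} [CommRing S] [Algebra S R] (𝒜 : ZMod 2 → Submodule R V) :
    IsScalarTower S R (SuperPoly 𝒜) :=
  inferInstanceAs (IsScalarTower S R (RingQuot (SuperCommRel 𝒜)))

/-- The quotient map from the tensor algebra of `V*`. -/
def SuperPoly.mk (𝒜 : ZMod 2 → Submodule R V) :
    TensorAlgebra R (Module.Dual R V) →ₐ[R] SuperPoly 𝒜 :=
  RingQuot.mkAlgHom R (SuperCommRel 𝒜)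

/-- The universal property: a linear map from `V*` to an algebra that respects the
supercommutativity relations extends to polynomials. -/
def SuperPoly.lift {B : Type*} [Ring B] [Algebra R B]
    (𝒜 : ZMod 2 → Submodule R V) (f : Module.Dual R V →ₗ[R] B)
    (hf : ∀ {i j : ZMod 2} {α β : Module.Dual R V}, α ∈ dualPart 𝒜 i → β ∈ dualPart 𝒜 j →
      f α * f β = ((-1 : ℤˣ) ^ (i * j)) • (f β * f α)) : SuperPoly 𝒜 →ₐ[R] B :=
  RingQuot.liftAlgHom R
    ⟨TensorAlgebra.lift R f, by
      rintro _ _ ⟨hα, hβ⟩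
      rw [Units.smul_def, map_zsmul, map_mul, map_mul, TensorAlgebra.lift_ι_apply,
        TensorAlgebra.lift_ι_apply, hf hα hβ, Units.smul_def]⟩

/-- A linear functional on `V`, as a polynomial on `V`. -/
def coordFn (𝒜 : ZMod 2 → Submodule R V) : Module.Dual R V →ₗ[R] SuperPoly 𝒜 :=
  (SuperPoly.mk 𝒜).toLinearMap ∘ₗ TensorAlgebra.ι R

theorem SuperPoly.lift_coordFn {B : Type*} [Ring B] [Algebra R B]
    (𝒜 : ZMod 2 → Submodule R V) (f : Module.Dual R V →ₗ[R] B)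
    (hf : ∀ {i j : ZMod 2} {α β : Module.Dual R V}, α ∈ dualPart 𝒜 i → β ∈ dualPart 𝒜 j →
      f α * f β = ((-1 : ℤˣ) ^ (i * j)) • (f β * f α)) (α : Module.Dual R V) :
    SuperPoly.lift 𝒜 f hf (coordFn 𝒜 α) = f α := by
  have h := RingQuot.liftAlgHom_mkAlgHom_apply (S := R) (TensorAlgebra.lift R f)
    (s := SuperCommRel 𝒜) (by
      rintro _ _ ⟨hα, hβ⟩
      rw [Units.smul_def, map_zsmul, map_mul, map_mul, TensorAlgebra.lift_ι_apply,
        TensorAlgebra.lift_ι_apply, hf hα hβ, Units.smul_def]) (TensorAlgebra.ι R α)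
  rw [TensorAlgebra.lift_ι_apply] at h
  exact h

/-- Polynomials are generated by the linear functionals. -/
theorem SuperPoly.induction (𝒜 : ZMod 2 → Submodule R V) {C : SuperPoly 𝒜 → Prop}
    (hone : C 1) (hadd : ∀ F G, C F → C G → C (F + G)) (hsmul : ∀ (c : R) F, C F → C (c • F))
    (hmul : ∀ α F, C F → C (coordFn 𝒜 α * F)) (F : SuperPoly 𝒜) : C F := by
  have key : ∀ (x : TensorAlgebra R (Module.Dual R V)) (F : SuperPoly 𝒜), C F →
      C (SuperPoly.mk 𝒜 x * F) := by
    intro x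
    induction x using TensorAlgebra.induction with
    | algebraMap r =>
      intro F hF
      rw [AlgHom.commutes]
      have := hsmul r F hF
      rwa [Algebra.smul_def] at this
    | ι α => intro F hF; exact hmul α F hF
    | mul a b ha hb =>
      intro F hF
      have := ha _ (hb F hF)
      rw [← mul_assoc] at this
      rw [map_mul]; exact this
    | add a b ha hb =>
      intro F hF
      have := hadd _ _ (ha F hF) (hb F hF)
      rw [← add_mul] at this
      rw [map_add]; exact this
  obtain ⟨x, rfl⟩ : ∃ x, SuperPoly.mk 𝒜 x = F :=
    RingQuot.mkAlgHom_surjective R (SuperCommRel 𝒜) F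
  have := key x 1 hone
  rwa [mul_one] at this

theorem coordFn_swap (𝒜 : ZMod 2 → Submodule R V) {i j : ZMod 2} {α β : Module.Dual R V}
    (hα : α ∈ dualPart 𝒜 i) (hβ : β ∈ dualPart 𝒜 j) :
    coordFn 𝒜 α * coordFn 𝒜 β = ((-1 : ℤˣ) ^ (i * j)) • (coordFn 𝒜 β * coordFn 𝒜 α) := by
  have h : SuperPoly.mk 𝒜 _ = SuperPoly.mk 𝒜 _ :=
    RingQuot.mkAlgHom_rel R (SuperCommRel.swap hα hβ)
  rw [map_mul] at h
  simp only [coordFn, LinearMap.comp_apply, AlgHom.toLinearMap_apply]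
  rw [h, Units.smul_def, Units.smul_def, map_zsmul, map_mul]

/-- The linear functional `α` acted on by a homogeneous operator `L` of parity `i`, in the
contragredient way: `v ↦ - (-1) ^ (i * p(α)) α (L v)`. -/
def dualAct (𝒜 : ZMod 2 → Submodule R V) [DirectSum.Decomposition 𝒜] (i : ZMod 2)
    (L : V →ₗ[R] V) : Module.Dual R V →ₗ[R] Module.Dual R V :=
  -(LinearMap.lcomp R R (parityTwist 𝒜 i ∘ₗ L))

theorem dualPart_apply_of_mem (𝒜 : ZMod 2 → Submodule R V) {i j : ZMod 2}
    {α : Module.Dual R V} (hα : α ∈ dualPart 𝒜 i) {v : V} (hv : v ∈ 𝒜 j) (hij : j ≠ i) :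
    α v = 0 := by
  have h : j = i + 1 := (by decide : ∀ i j : ZMod 2, j ≠ i → j = i + 1) i j hij
  subst h
  exact (Submodule.mem_dualAnnihilator α).1 hα v hv

theorem dual_ext_of_mem (𝒜 : ZMod 2 → Submodule R V) [DirectSum.Decomposition 𝒜]
    {α β : Module.Dual R V} (h : ∀ j, ∀ v ∈ 𝒜 j, α v = β v) : α = β := by
  ext v
  induction v using DirectSum.Decomposition.inductionOn 𝒜 with
  | zero => simp
  | homogeneous m => exact h _ _ m.2
  | add _ _ h₁ h₂ => simp [h₁, h₂]

theorem dual_comp_parityTwist (𝒜 : ZMod 2 → Submodule R V) [DirectSum.Decomposition 𝒜]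
    (i : ZMod 2) {j : ZMod 2} {α : Module.Dual R V} (hα : α ∈ dualPart 𝒜 j) :
    α ∘ₗ parityTwist 𝒜 i = ((-1 : ℤˣ) ^ (i * j)) • α := by
  refine dual_ext_of_mem 𝒜 fun k v hv => ?_
  rw [LinearMap.comp_apply, parityTwist_of_mem 𝒜 i hv, LinearMap.smul_apply, Units.smul_def,
    Units.smul_def, map_zsmul]
  by_cases hk : k = j
  · rw [hk]
  · simp [dualPart_apply_of_mem 𝒜 hα hv hk]

theorem dualAct_apply_of_mem (𝒜 : ZMod 2 → Submodule R V) [DirectSum.Decomposition 𝒜]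
    (i : ZMod 2) (L : V →ₗ[R] V) {j : ZMod 2} {α : Module.Dual R V} (hα : α ∈ dualPart 𝒜 j)
    (v : V) : dualAct 𝒜 i L α v = -(((-1 : ℤˣ) ^ (i * j)) • α (L v)) := by
  have h := LinearMap.congr_fun (dual_comp_parityTwist 𝒜 i hα) (L v)
  simpa [dualAct] using h

theorem dualAct_mem (𝒜 : ZMod 2 → Submodule R V) [DirectSum.Decomposition 𝒜]
    {i : ZMod 2} {L : V →ₗ[R] V} (hL : ∀ j, ∀ v ∈ 𝒜 j, L v ∈ 𝒜 (i + j)) {j : ZMod 2}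
    {α : Module.Dual R V} (hα : α ∈ dualPart 𝒜 j) : dualAct 𝒜 i L α ∈ dualPart 𝒜 (i + j) := by
  refine (Submodule.mem_dualAnnihilator _).2 fun v hv => ?_
  rw [dualAct_apply_of_mem 𝒜 i L hα, dualPart_apply_of_mem 𝒜 hα (hL _ v hv), smul_zero, neg_zero]
  exact (by decide : ∀ i j : ZMod 2, i + (i + j + 1) ≠ j) i j

/-- The matrix `!![φ α, D α; 0, α]`, where `φ α = (-1) ^ (i * p(α)) α` and
`D α = dualAct 𝒜 i L α`. -/
def superDerGen (𝒜 : ZMod 2 → Submodule R V) [DirectSum.Decomposition 𝒜] (i : ZMod 2)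
    (L : V →ₗ[R] V) : Module.Dual R V →ₗ[R] Matrix (Fin 2) (Fin 2) (SuperPoly 𝒜) where
  toFun α := !![coordFn 𝒜 (α ∘ₗ parityTwist 𝒜 i), coordFn 𝒜 (dualAct 𝒜 i L α); 0, coordFn 𝒜 α]
  map_add' α β := by
    ext a b; fin_cases a <;> fin_cases b <;> simp [LinearMap.add_comp]
  map_smul' c α := by
    ext a b; fin_cases a <;> fin_cases b <;> simp [LinearMap.smul_comp]

theorem superDerGen_swap (𝒜 : ZMod 2 → Submodule R V) [DirectSum.Decomposition 𝒜] {i : ZMod 2}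
    {L : V →ₗ[R] V} (hL : ∀ j, ∀ v ∈ 𝒜 j, L v ∈ 𝒜 (i + j)) {j k : ZMod 2}
    {α β : Module.Dual R V} (hα : α ∈ dualPart 𝒜 j) (hβ : β ∈ dualPart 𝒜 k) :
    superDerGen 𝒜 i L α * superDerGen 𝒜 i L β =
      ((-1 : ℤˣ) ^ (j * k)) • (superDerGen 𝒜 i L β * superDerGen 𝒜 i L α) := by
  have h1 := coordFn_swap 𝒜 hα hβ
  have h2 := coordFn_swap 𝒜 hα (dualAct_mem 𝒜 hL hβ)
  have h3 := coordFn_swap 𝒜 (dualAct_mem 𝒜 hL hα) hβ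
  have e1 := dual_comp_parityTwist 𝒜 i hα
  have e2 := dual_comp_parityTwist 𝒜 i hβ
  simp only [superDerGen, LinearMap.coe_mk, AddHom.coe_mk, e1, e2, Matrix.mul_fin_two,
    Matrix.smul_of, Units.smul_def, map_zsmul] at h1 h2 h3 ⊢
  generalize coordFn 𝒜 (dualAct 𝒜 i L α) = a' at *
  generalize coordFn 𝒜 (dualAct 𝒜 i L β) = b' at *
  generalize coordFn 𝒜 α = a at *
  generalize coordFn 𝒜 β = b at *
  clear e1 e2 hα hβ hL
  have cases2 : ∀ z : ZMod 2, z = 0 ∨ z = 1 := by decide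
  have h11 : (1 + 1 : ZMod 2) = 0 := by decide
  rcases cases2 i with rfl | rfl <;> rcases cases2 j with rfl | rfl <;>
    rcases cases2 k with rfl | rfl <;>
    ext p q <;> fin_cases p <;> fin_cases q <;>
    simp_all [add_comm]

/-- The algebra homomorphism `F ↦ !![φ F, D F; 0, F]` on polynomials, where `φ` is the
automorphism `F ↦ (-1) ^ (i * p(F)) F` and `D` is the superderivation of parity `i` that extends
`dualAct 𝒜 i L`. -/
def superDerHom (𝒜 : ZMod 2 → Submodule R V) [DirectSum.Decomposition 𝒜] (i : ZMod 2)
    (L : V →ₗ[R] V) (hL : ∀ j, ∀ v ∈ 𝒜 j, L v ∈ 𝒜 (i + j)) :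
    SuperPoly 𝒜 →ₐ[R] Matrix (Fin 2) (Fin 2) (SuperPoly 𝒜) :=
  SuperPoly.lift 𝒜 (superDerGen 𝒜 i L) fun hα hβ => superDerGen_swap 𝒜 hL hα hβ

theorem superDerHom_coordFn (𝒜 : ZMod 2 → Submodule R V) [DirectSum.Decomposition 𝒜]
    (i : ZMod 2) (L : V →ₗ[R] V) (hL : ∀ j, ∀ v ∈ 𝒜 j, L v ∈ 𝒜 (i + j))
    (α : Module.Dual R V) : superDerHom 𝒜 i L hL (coordFn 𝒜 α) =
      !![coordFn 𝒜 (α ∘ₗ parityTwist 𝒜 i), coordFn 𝒜 (dualAct 𝒜 i L α); 0, coordFn 𝒜 α] :=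
  SuperPoly.lift_coordFn 𝒜 _ _ α

/-- The superderivation of parity `i` of the algebra of polynomials on `V` induced by a homogeneous
operator `L` of parity `i` on `V`. -/
def superDer (𝒜 : ZMod 2 → Submodule R V) [DirectSum.Decomposition 𝒜] (i : ZMod 2)
    (L : V →ₗ[R] V) (hL : ∀ j, ∀ v ∈ 𝒜 j, L v ∈ 𝒜 (i + j)) : SuperPoly 𝒜 →ₗ[R] SuperPoly 𝒜 :=
  Matrix.entryLinearMap R (SuperPoly 𝒜) 0 1 ∘ₗ (superDerHom 𝒜 i L hL).toLinearMap

/-- On linear functionals, `superDer` is the contragredient action. -/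
theorem superDer_coordFn (𝒜 : ZMod 2 → Submodule R V) [DirectSum.Decomposition 𝒜]
    (i : ZMod 2) (L : V →ₗ[R] V) (hL : ∀ j, ∀ v ∈ 𝒜 j, L v ∈ 𝒜 (i + j))
    (α : Module.Dual R V) :
    superDer 𝒜 i L hL (coordFn 𝒜 α) = coordFn 𝒜 (dualAct 𝒜 i L α) := by
  simp [superDer, superDerHom_coordFn]

/-- The super Leibniz rule. -/
theorem superDer_coordFn_mul (𝒜 : ZMod 2 → Submodule R V) [DirectSum.Decomposition 𝒜]
    (i : ZMod 2) (L : V →ₗ[R] V) (hL : ∀ j, ∀ v ∈ 𝒜 j, L v ∈ 𝒜 (i + j)) {j : ZMod 2}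
    {α : Module.Dual R V} (hα : α ∈ dualPart 𝒜 j) (G : SuperPoly 𝒜) :
    superDer 𝒜 i L hL (coordFn 𝒜 α * G) = superDer 𝒜 i L hL (coordFn 𝒜 α) * G +
      ((-1 : ℤˣ) ^ (i * j)) • (coordFn 𝒜 α * superDer 𝒜 i L hL G) := by
  have h11 : superDerHom 𝒜 i L hL G 1 0 = 0 ∧ superDerHom 𝒜 i L hL G 1 1 = G := by
    induction G using SuperPoly.induction with
    | hone => simp
    | hadd F G hF hG => simp [hF, hG]
    | hsmul c F hF => simp [hF]
    | hmul α F hF =>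
      simp [superDerHom_coordFn, Matrix.mul_apply, Fin.sum_univ_two, hF]
  have e := dual_comp_parityTwist 𝒜 i hα
  simp only [superDer, LinearMap.comp_apply, AlgHom.toLinearMap_apply, map_mul,
    Matrix.entryLinearMap_apply, Matrix.mul_apply, Fin.sum_univ_two, h11.2]
  simp [superDerHom_coordFn, e, Units.smul_def, mul_assoc]
  rw [add_comm]

/-- A polynomial on `V` is invariant under a parity-preserving bilinear bracket on `V` if it is
annihilated by the coadjoint action of every homogeneous element, i.e. by the superderivations
induced by the operators `ad x = br x`. -/
def IsInvariantPoly (𝒜 : ZMod 2 → Submodule R V) [DirectSum.Decomposition 𝒜]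
    (br : V →ₗ[R] V →ₗ[R] V) (hbr : ∀ i j, ∀ x ∈ 𝒜 i, ∀ y ∈ 𝒜 j, br x y ∈ 𝒜 (i + j))
    (F : SuperPoly 𝒜) : Prop :=
  ∀ (i : ZMod 2) (x : V) (hx : x ∈ 𝒜 i), superDer 𝒜 i (br x) (fun j => hbr i j x hx) F = 0

/-- The supercommutator `[x, y] = x y - (-1) ^ (p(x) p(y)) y x` of a superalgebra. -/
def superCommutator {A : Type*} [Ring A] [Algebra R A] (𝒜 : ZMod 2 → Submodule R A)
    [GradedAlgebra 𝒜] : A →ₗ[R] A →ₗ[R] A :=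
  LinearMap.mul R A - ∑ i : ZMod 2, ∑ j : ZMod 2, ((-1 : ℤˣ) ^ (i * j)) •
    (LinearMap.mul R A).flip.compl₁₂ (parityProj 𝒜 i) (parityProj 𝒜 j)

theorem superCommutator_of_mem {A : Type*} [Ring A] [Algebra R A] (𝒜 : ZMod 2 → Submodule R A)
    [GradedAlgebra 𝒜] {i j : ZMod 2} {x y : A} (hx : x ∈ 𝒜 i) (hy : y ∈ 𝒜 j) :
    superCommutator 𝒜 x y = x * y - ((-1 : ℤˣ) ^ (i * j)) • (y * x) := by
  have h : ∀ k l : ZMod 2, ((LinearMap.mul R A).flip.compl₁₂ (parityProj 𝒜 k)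
      (parityProj 𝒜 l)) x y = if l = j then if k = i then y * x else 0 else 0 := by
    intro k l
    rw [LinearMap.compl₁₂_apply, parityProj_of_mem 𝒜 hx, parityProj_of_mem 𝒜 hy]
    split_ifs <;> simp
  simp [superCommutator, LinearMap.sum_apply, LinearMap.sub_apply, LinearMap.smul_apply, h]

theorem superCommutator_mem {A : Type*} [Ring A] [Algebra R A] (𝒜 : ZMod 2 → Submodule R A)
    [GradedAlgebra 𝒜] (i j : ZMod 2) (x : A) (hx : x ∈ 𝒜 i) (y : A) (hy : y ∈ 𝒜 j) :
    superCommutator 𝒜 x y ∈ 𝒜 (i + j) := by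
  rw [superCommutator_of_mem 𝒜 hx hy, Units.smul_def]
  exact sub_mem (SetLike.mul_mem_graded hx hy)
    (zsmul_mem (add_comm j i ▸ SetLike.mul_mem_graded hy hx) _)

end Super

/-! ## Grassmann and Clifford superalgebras -/

section Cliff

variable (r s : ℕ)

/-- Indices of the generators `ξ₁ < … < ξᵣ < η₁ < … < ηᵣ < θ₁ < … < θₛ`. -/
abbrev Gen : Type := Fin r ⊕ₗ (Fin r ⊕ₗ Fin s)

variable {r s}

/-- The index of the generator `ξᵢ`. -/
def Gen.xi (i : Fin r) : Gen r s := Sum.inlₗ i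

/-- The index of the generator `ηᵢ`. -/
def Gen.eta (i : Fin r) : Gen r s := Sum.inrₗ (Sum.inlₗ i)

/-- The index of the generator `θⱼ`. -/
def Gen.theta (j : Fin s) : Gen r s := Sum.inrₗ (Sum.inrₗ j)

variable (r s)

/-- The Grassmann superalgebra on the generators `ξᵢ`, `ηᵢ`, `θⱼ`; its grading by parity is
`CliffordAlgebra.evenOdd 0`. -/
abbrev Grassmann (R : Type*) [CommRing R] : Type _ := ExteriorAlgebra R (Gen r s → R)

variable {r s}

/-- The left partial derivative with respect to the generator with index `a`. -/
def pderivGrassmann {R : Type*} [CommRing R] (a : Gen r s) :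
    Grassmann r s R →ₗ[R] Grassmann r s R :=
  CliffordAlgebra.contractLeft (Q := 0) (LinearMap.proj a : (Gen r s → R) →ₗ[R] R)

variable (r s)

/-- The Poisson bracket
`{f, g} = (-1) ^ p(f) (∑ᵢ (∂f/∂ξᵢ ∂g/∂ηᵢ + ∂f/∂ηᵢ ∂g/∂ξᵢ) + ∑ⱼ ∂f/∂θⱼ ∂g/∂θⱼ)`,
where the sign is inserted by the grading involution `f ↦ (-1) ^ p(f) f`. -/
def poissonBracket (R : Type*) [CommRing R] :
    Grassmann r s R →ₗ[R] Grassmann r s R →ₗ[R] Grassmann r s R :=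
  (∑ i : Fin r,
      ((LinearMap.mul R (Grassmann r s R)).compl₁₂ (pderivGrassmann (.xi i)) (pderivGrassmann (.eta i))
        + (LinearMap.mul R (Grassmann r s R)).compl₁₂ (pderivGrassmann (.eta i))
          (pderivGrassmann (.xi i)))
    + ∑ j : Fin s, (LinearMap.mul R (Grassmann r s R)).compl₁₂ (pderivGrassmann (.theta j))
        (pderivGrassmann (.theta j))) ∘ₗ
    (CliffordAlgebra.involute (Q := (0 : QuadraticForm R (Gen r s → R)))).toLinearMap

theorem pderivGrassmann_mem {R : Type*} [CommRing R] (a : Gen r s) (i : ZMod 2)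
    (f : Grassmann r s R) (hf : f ∈ CliffordAlgebra.evenOdd 0 i) :
    pderivGrassmann a f ∈ CliffordAlgebra.evenOdd (0 : QuadraticForm R (Gen r s → R)) (i + 1) := by
  refine CliffordAlgebra.evenOdd_induction (0 : QuadraticForm R (Gen r s → R)) i
    (motive := fun f _ => pderivGrassmann a f ∈
      CliffordAlgebra.evenOdd (0 : QuadraticForm R (Gen r s → R)) (i + 1)) ?_ ?_ ?_ f hf
  · intro v h
    obtain rfl | rfl := (by decide : ∀ z : ZMod 2, z = 0 ∨ z = 1) i
    · rw [ZMod.val_zero, pow_zero] at h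
      obtain ⟨c, rfl⟩ := Submodule.mem_one.1 h
      rw [pderivGrassmann, CliffordAlgebra.contractLeft_algebraMap]
      exact zero_mem _
    · rw [ZMod.val_one, pow_one] at h
      obtain ⟨m, rfl⟩ := h
      rw [pderivGrassmann, CliffordAlgebra.contractLeft_ι, Algebra.algebraMap_eq_smul_one]
      exact Submodule.smul_mem _ _ (SetLike.one_mem_graded (CliffordAlgebra.evenOdd _))
  · intro x y hx hy ihx ihy
    rw [map_add]
    exact add_mem ihx ihy
  · intro m₁ m₂ x hx ih
    have h1 : ∀ (m : Gen r s → R) {k : ZMod 2} {y : Grassmann r s R},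
        y ∈ CliffordAlgebra.evenOdd 0 k → CliffordAlgebra.ι 0 m * y ∈
          CliffordAlgebra.evenOdd (0 : QuadraticForm R (Gen r s → R)) (k + 1) := by
      intro m k y hy
      rw [add_comm]
      exact SetLike.mul_mem_graded (CliffordAlgebra.ι_mem_evenOdd_one 0 m) hy
    rw [pderivGrassmann, mul_assoc, CliffordAlgebra.contractLeft_ι_mul,
      CliffordAlgebra.contractLeft_ι_mul]
    refine sub_mem (Submodule.smul_mem _ _ (h1 m₂ hx)) ?_
    have h2 := h1 m₁ (sub_mem (Submodule.smul_mem _ (LinearMap.proj (R := R) a m₂) hx)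
      ((by decide : ∀ i : ZMod 2, i + 1 + 1 = i) i ▸ h1 m₂ ih))
    exact h2

theorem poissonBracket_mem (R : Type*) [CommRing R] (i j : ZMod 2) (f : Grassmann r s R)
    (hf : f ∈ CliffordAlgebra.evenOdd 0 i) (g : Grassmann r s R)
    (hg : g ∈ CliffordAlgebra.evenOdd 0 j) :
    poissonBracket r s R f g ∈
      CliffordAlgebra.evenOdd (0 : QuadraticForm R (Gen r s → R)) (i + j) := by
  have hf' := (CliffordAlgebra.involute_mem_evenOdd_iff 0).2 hf
  have key : ∀ a b : Gen r s, pderivGrassmann a (CliffordAlgebra.involute f) *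
      pderivGrassmann b g ∈
        CliffordAlgebra.evenOdd (0 : QuadraticForm R (Gen r s → R)) (i + j) := by
    intro a b
    have h := SetLike.mul_mem_graded (pderivGrassmann_mem r s a i _ hf')
      (pderivGrassmann_mem r s b j g hg)
    rwa [(by decide : ∀ i j : ZMod 2, i + 1 + (j + 1) = i + j) i j] at h
  simp only [poissonBracket, LinearMap.comp_apply, LinearMap.add_apply, LinearMap.sum_apply,
    LinearMap.compl₁₂_apply, LinearMap.mul_apply', AlgHom.toLinearMap_apply]
  exact add_mem (sum_mem fun _ _ => add_mem (key _ _) (key _ _)) (sum_mem fun _ _ => key _ _)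

/-- The (non-symmetric) bilinear form `h (∑ᵢ ηᵢ(u) ξᵢ(v) + ½ ∑ⱼ θⱼ(u) θⱼ(v))`. -/
def cliffBilin {K : Type*} [Field K] (h : K) : LinearMap.BilinForm K (Gen r s → K) :=
  h • (∑ i : Fin r, (LinearMap.mul K K).compl₁₂ (LinearMap.proj (.eta i)) (LinearMap.proj (.xi i))
    + (2⁻¹ : K) • ∑ j : Fin s, (LinearMap.mul K K).compl₁₂ (LinearMap.proj (.theta j))
        (LinearMap.proj (.theta j)))

/-- The quadratic form `h (∑ᵢ ξᵢ ηᵢ + ½ ∑ⱼ θⱼ²)`. -/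
def cliffForm {K : Type*} [Field K] (h : K) : QuadraticForm K (Gen r s → K) :=
  (cliffBilin r s h).toQuadraticMap

theorem cliffBilin_toQuadraticMap {K : Type*} [Field K] (h : K) :
    (cliffBilin r s h).toQuadraticMap = cliffForm r s h - 0 :=
  (sub_zero (cliffForm r s h)).symm

theorem cliffForm_apply {K : Type*} [Field K] (h : K) (v : Gen r s → K) :
    cliffForm r s h v = h * (∑ i : Fin r, v (.xi i) * v (.eta i)
      + 2⁻¹ * ∑ j : Fin s, v (.theta j) ^ 2) := by
  simp [cliffForm, cliffBilin, mul_comm, sq, mul_add]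

/-- The Clifford superalgebra with the odd generators `ξ̂ᵢ`, `η̂ᵢ`, `θ̂ⱼ` and the relations
`ξ̂ᵢ η̂ⱼ + η̂ⱼ ξ̂ᵢ = δᵢⱼ h`, `θ̂ᵢ θ̂ⱼ + θ̂ⱼ θ̂ᵢ = δᵢⱼ h`, all other pairs of generators anticommuting; its
grading by parity is `CliffordAlgebra.evenOdd (cliffForm r s h)`. -/
abbrev Cliff {K : Type*} [Field K] (h : K) : Type _ := CliffordAlgebra (cliffForm r s h)

variable {r s}

/-- The ordered monomial `ξ̂_I η̂_J θ̂_L` in the generators of the Clifford algebra of `q`, where `S` is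
the union of `I`, `J`, `L`. -/
def cliffMonomial {R : Type*} [CommRing R] (q : QuadraticForm R (Gen r s → R))
    (S : Finset (Gen r s)) : CliffordAlgebra q :=
  (S.sort.map fun a => CliffordAlgebra.ι q (Pi.single a 1)).prod

variable (r s)

/-- The monomials `ξ_I η_J θ_L` form a basis of the Grassmann superalgebra. -/
def grassmannBasis (R : Type*) [CommRing R] :
    Module.Basis (Finset (Gen r s)) R (Grassmann r s R) :=
  (Pi.basisFun R (Gen r s)).ExteriorAlgebra

theorem grassmannBasis_apply (R : Type*) [CommRing R] (S : Finset (Gen r s)) :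
    grassmannBasis r s R S = cliffMonomial 0 S := by
  rw [grassmannBasis, ExteriorAlgebra.basis_apply_ofCard _ (rfl : S.card = S.card),
    ExteriorAlgebra.ιMulti_family, ExteriorAlgebra.ιMulti_apply, cliffMonomial,
    ← Finset.listMap_orderEmbOfFin_finRange S rfl, List.map_map, ← List.ofFn_eq_map]
  congr 2
  ext i
  simp [Pi.basisFun_apply]
  rfl

/-- The monomials `ξ̂_I η̂_J θ̂_L` form a basis of the Clifford superalgebra. -/
def cliffBasis {K : Type*} [Field K] (h : K) : Module.Basis (Finset (Gen r s)) K (Cliff r s h) :=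
  (grassmannBasis r s K).map
    (CliffordAlgebra.changeFormEquiv (cliffBilin_toQuadraticMap r s h))

theorem cliffBilin_single {K : Type*} [Field K] (h : K) {a b : Gen r s} (hab : a < b) :
    cliffBilin r s h (Pi.single a 1) (Pi.single b 1) = 0 := by
  have h1 : ∀ i : Fin r, (Pi.single a 1 : Gen r s → K) (.eta i) *
      (Pi.single b 1 : Gen r s → K) (.xi i) = 0 := by
    intro i
    by_cases ha : Gen.eta i = a
    · rw [Pi.single_eq_of_ne (i := b) (i' := Gen.xi i), mul_zero]
      rintro rfl
      subst ha
      simp [Gen.xi, Gen.eta] at hab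
    · rw [Pi.single_eq_of_ne ha, zero_mul]
  have h2 : ∀ j : Fin s, (Pi.single a 1 : Gen r s → K) (.theta j) *
      (Pi.single b 1 : Gen r s → K) (.theta j) = 0 := by
    intro j
    by_cases ha : Gen.theta j = a
    · rw [Pi.single_eq_of_ne (i := b) (i' := Gen.theta j), mul_zero]
      rw [ha]
      exact hab.ne
    · rw [Pi.single_eq_of_ne ha, zero_mul]
  simp [cliffBilin, h1, h2]

theorem cliffBasis_apply {K : Type*} [Field K] (h : K) (S : Finset (Gen r s)) :
    cliffBasis r s h S = cliffMonomial (cliffForm r s h) S := by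
  have key : ∀ l : List (Gen r s), l.Pairwise (· < ·) →
      CliffordAlgebra.changeForm (cliffBilin_toQuadraticMap r s h)
        (l.map fun a => CliffordAlgebra.ι 0 (Pi.single a 1)).prod =
        (l.map fun a => CliffordAlgebra.ι (cliffForm r s h) (Pi.single a 1)).prod := by
    intro l hl
    induction l with
    | nil => simp
    | cons a l ih =>
      rw [List.pairwise_cons] at hl
      rw [List.map_cons, List.prod_cons, CliffordAlgebra.changeForm_ι_mul, ih hl.2, List.map_cons,
        List.prod_cons, sub_eq_self]
      replace hl := hl.1
      clear ih
      induction l with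
      | nil => simp
      | cons b l ih =>
        rw [List.map_cons, List.prod_cons, CliffordAlgebra.contractLeft_ι_mul,
          cliffBilin_single r s h (hl b (by simp)), ih fun c hc => hl c (by simp [hc])]
        simp
  rw [cliffBasis, Module.Basis.map_apply, grassmannBasis_apply]
  exact key _ S.sortedLT_sort.pairwise

theorem cliffMonomial_mem {R : Type*} [CommRing R] (q : QuadraticForm R (Gen r s → R))
    (S : Finset (Gen r s)) : cliffMonomial q S ∈ CliffordAlgebra.evenOdd q (S.card : ZMod 2) := by
  rw [cliffMonomial, ← S.length_sort (· ≤ ·)]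
  induction S.sort (· ≤ ·) with
  | nil => simpa using SetLike.one_mem_graded (CliffordAlgebra.evenOdd q)
  | cons a l ih =>
    rw [List.map_cons, List.prod_cons, List.length_cons, Nat.cast_succ, add_comm]
    exact SetLike.mul_mem_graded (CliffordAlgebra.ι_mem_evenOdd_one q _) ih

/-! ## Quantization -/

section Quantize

variable {K : Type*} [Field K] [Algebra ℂ K] (h : K)

/-- The quantization map `Q` on functions: `Q(ξ_I η_J θ_L) = ξ̂_I η̂_J θ̂_L`. -/
def quantize : Grassmann r s ℂ →ₗ[ℂ] Cliff r s h :=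
  (grassmannBasis r s ℂ).constr ℂ fun S => cliffMonomial (cliffForm r s h) S

/-- The quantization map on coordinate functions: `quantizeDual α` is the unique `K`-linear
functional whose value on `Q(f)` is `α f`. -/
def quantizeDual : Module.Dual ℂ (Grassmann r s ℂ) →ₗ[ℂ] Module.Dual K (Cliff r s h) :=
  ((cliffBasis r s h).constr ℂ).toLinearMap ∘ₗ
    LinearMap.pi fun S => (Algebra.linearMap ℂ K) ∘ₗ
      Module.Dual.eval ℂ (Grassmann r s ℂ) (grassmannBasis r s ℂ S)

theorem quantizeDual_monomial (α : Module.Dual ℂ (Grassmann r s ℂ)) (S : Finset (Gen r s)) :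
    quantizeDual r s h α (cliffMonomial (cliffForm r s h) S) =
      algebraMap ℂ K (α (cliffMonomial 0 S)) := by
  rw [← cliffBasis_apply, ← grassmannBasis_apply]
  simp [quantizeDual]

theorem quantizeDual_quantize (α : Module.Dual ℂ (Grassmann r s ℂ)) (f : Grassmann r s ℂ) :
    quantizeDual r s h α (quantize r s h f) = algebraMap ℂ K (α f) := by
  have : ((quantizeDual r s h α).restrictScalars ℂ) ∘ₗ quantize r s h =
      Algebra.linearMap ℂ K ∘ₗ α := by
    refine (grassmannBasis r s ℂ).ext fun S => ?_
    rw [LinearMap.comp_apply, LinearMap.comp_apply, quantize, Module.Basis.constr_basis,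
      LinearMap.restrictScalars_apply, quantizeDual_monomial, grassmannBasis_apply,
      Algebra.linearMap_apply]
  exact LinearMap.congr_fun this f

theorem quantizeDual_mem {i : ZMod 2} {α : Module.Dual ℂ (Grassmann r s ℂ)}
    (hα : α ∈ dualPart (CliffordAlgebra.evenOdd 0) i) :
    quantizeDual r s h α ∈ dualPart (CliffordAlgebra.evenOdd (cliffForm r s h)) i := by
  have hS : ∀ S : Finset (Gen r s), quantizeDual r s h α
      (parityTwist (CliffordAlgebra.evenOdd (cliffForm r s h)) 1
        (cliffMonomial (cliffForm r s h) S)) =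
      ((-1 : ℤˣ) ^ i) • quantizeDual r s h α (cliffMonomial (cliffForm r s h) S) := by
    intro S
    have e := LinearMap.congr_fun (dual_comp_parityTwist _ 1 hα) (cliffMonomial 0 S)
    rw [LinearMap.comp_apply, parityTwist_of_mem _ 1 (cliffMonomial_mem _ _ 0 S), Units.smul_def,
      map_zsmul, LinearMap.smul_apply, one_mul, one_mul] at e
    rw [parityTwist_of_mem _ 1 (cliffMonomial_mem _ _ _ S), Units.smul_def, Units.smul_def, map_zsmul,
      quantizeDual_monomial, one_mul, ← map_zsmul, e, Units.smul_def, map_zsmul]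
  have hx : ∀ x, quantizeDual r s h α
      (parityTwist (CliffordAlgebra.evenOdd (cliffForm r s h)) 1 x) =
      ((-1 : ℤˣ) ^ i) • quantizeDual r s h α x := by
    intro x
    have : quantizeDual r s h α ∘ₗ parityTwist (CliffordAlgebra.evenOdd (cliffForm r s h)) 1 =
        ((-1 : ℤˣ) ^ i) • quantizeDual r s h α := by
      refine (cliffBasis r s h).ext fun S => ?_
      rw [cliffBasis_apply]
      exact hS S
    exact LinearMap.congr_fun this x
  refine (Submodule.mem_dualAnnihilator _).2 fun v hv => ?_
  have e := hx v
  rw [parityTwist_of_mem _ 1 hv, Units.smul_def, Units.smul_def, map_zsmul, one_mul] at e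
  have : CharZero K := charZero_of_injective_algebraMap (algebraMap ℂ K).injective
  obtain rfl | rfl := (by decide : ∀ z : ZMod 2, z = 0 ∨ z = 1) i
  · simpa [neg_eq_self] using e
  · simpa [(by decide : (1 + 1 : ZMod 2) = 0), self_eq_neg] using e

/-- The quantization map `Q` on polynomials: the algebra homomorphism that extends
`quantizeDual`. It expresses a polynomial in the coordinates of `f` as the same polynomial in the
coordinates of `Q(f)`. -/
def quantizePoly :
    SuperPoly (CliffordAlgebra.evenOdd (0 : QuadraticForm ℂ (Gen r s → ℂ))) →ₐ[ℂ]
      SuperPoly (CliffordAlgebra.evenOdd (cliffForm r s h)) :=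
  SuperPoly.lift _ ((coordFn _).restrictScalars ℂ ∘ₗ quantizeDual r s h) fun hα hβ =>
    coordFn_swap _ (quantizeDual_mem r s h hα) (quantizeDual_mem r s h hβ)

end Quantize

/-! ## Invariant polynomials and expansion in powers of `ħ` -/

/-- Polynomials on the Poisson superalgebra `po(0|2r+s)` over `ℂ`. -/
abbrev PoPoly : Type := SuperPoly (CliffordAlgebra.evenOdd (0 : QuadraticForm ℂ (Gen r s → ℂ)))

/-- Invariance of a polynomial on `po(0|2r+s)`, the Grassmann superalgebra with the Poisson
bracket. -/
def IsPoInvariant (P : PoPoly r s) : Prop :=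
  IsInvariantPoly (CliffordAlgebra.evenOdd (0 : QuadraticForm ℂ (Gen r s → ℂ)))
    (poissonBracket r s ℂ) (poissonBracket_mem r s ℂ) P

/-- The element `t ^ k` of `ℂ((t))`. -/
def tPow (k : ℤ) : LaurentSeries ℂ := HahnSeries.single k 1

/-- The deformation parameter `ħ = t ^ e` in `ℂ((t))`, so that `t = ħ^(1/e)`. -/
def hbar (e : ℕ) : LaurentSeries ℂ := tPow e

/-- Polynomials on the Clifford superalgebra `Cliff_ħ` over `ℂ((t))`. -/
abbrev CliffPoly (e : ℕ) : Type := SuperPoly (CliffordAlgebra.evenOdd (cliffForm r s (hbar e)))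

/-- Invariance of a polynomial on `Cliff_ħ`, considered as a Lie superalgebra with the
supercommutator. -/
def IsCliffInvariant (e : ℕ) (F : CliffPoly r s e) : Prop :=
  IsInvariantPoly (CliffordAlgebra.evenOdd (cliffForm r s (hbar e)))
    (superCommutator (CliffordAlgebra.evenOdd (cliffForm r s (hbar e))))
    (superCommutator_mem (CliffordAlgebra.evenOdd (cliffForm r s (hbar e)))) F

/-- The polynomials on `Cliff_ħ` that are `O(t ^ N)`: finite sums of terms `c Q(G)`, where `G` is a
polynomial on the Grassmann superalgebra over `ℂ` and `c ∈ t ^ N ℂ[[t]]`. -/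
def bigO (e : ℕ) (N : ℤ) : AddSubgroup (CliffPoly r s e) :=
  AddSubgroup.closure {H | ∃ (c : LaurentSeries ℂ) (G : PoPoly r s),
    (∀ k < N, c.coeff k = 0) ∧ H = c • quantizePoly r s (hbar e) G}

/-- `F = ∑_{k ≥ k₀} F_k t ^ k`, where the `F_k` do not depend on `t`, i.e. are polynomials with
complex coefficients in the coordinates with respect to the basis `ξ̂_I η̂_J θ̂_L`. -/
structure HasExpansion (e : ℕ) (F : CliffPoly r s e) (k₀ : ℤ) (Fk : ℤ → CliffPoly r s e) :
    Prop where
  mem_range : ∀ k, Fk k ∈ Set.range (quantizePoly r s (hbar e))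
  sub_mem : ∀ N : ℤ, F - ∑ k ∈ Finset.Ico k₀ N, tPow k • Fk k ∈ bigO r s e N

end Cliff

end

/-!
The supercommutator of the Clifford algebra is a deformation of the Poisson bracket:
`[Q f, Q g] = -ħ Q {f, g} + O(ħ²)`. Quantization is the change of quadratic form by the bilinear
form `cliffBilin`, so that multiplication by a generator on the Clifford side is the exterior
product plus `ħ` times a contraction (`ι_mul_quantize`). By induction on the left factor, the
product is `Q f * Q g = Q (f g) + ħ Q (wickProduct f g) + O(ħ²)`
(`exists_quantize_mul_sub_sub_eq`). The supercommutator kills the exterior product and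
antisymmetrizes the first-order term to `-{f, g}` (`wickProduct_sub_swap`).

Dualizing and extending by the Leibniz rule, the superderivation of polynomials induced by
`ad (Q f)` takes `Q G` to `-ħ Q (D G) + O(ħ²)`, where `D` is the superderivation induced by
`{f, ·}` (`exists_superDer_quantizePoly_add_eq`). Here `O(ħ²)` means `ħ²` times an element of the
lattice spanned over a subalgebra `A` of `K` containing `ħ` by the image of `Q` (`imageLattice`).

If `F = t ^ k₀ Q P + O(t ^ (k₀ + 1))` is annihilated by `ad (Q f)`, then the term of order
`t ^ (k₀ + e)` of the resulting equation is `-Q (D P)`. To conclude that `D P = 0` one needs that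
`Q` identifies polynomials on the Clifford algebra with polynomials on the Grassmann algebra tensored
with `K`, so that coefficients are well defined (`dequantizePoly`, `coeffPoly`). The comparison of
coefficients is `superDer_poisson_eq_zero`; it is carried out over a general field `K` with an
arbitrary functional in place of the coefficient of `t ^ (k₀ + e)`.
-/

noncomputable section

/-! ### Parity and supercommutativity -/

theorem Grassmann.mul_ι (r s : ℕ) {R : Type*} [CommRing R] (f : Grassmann r s R) (v : Gen r s → R) :
    f * CliffordAlgebra.ι 0 v = CliffordAlgebra.ι 0 v * CliffordAlgebra.involute f := by
  induction f using CliffordAlgebra.left_induction with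
  | algebraMap c => rw [AlgHom.commutes, Algebra.commutes]
  | add x y hx hy => rw [add_mul, hx, hy, map_add, mul_add]
  | ι_mul x w hx =>
    have hvw : CliffordAlgebra.ι (0 : QuadraticForm R (Gen r s → R)) w * CliffordAlgebra.ι 0 v =
        -(CliffordAlgebra.ι 0 v * CliffordAlgebra.ι 0 w) :=
      eq_neg_of_add_eq_zero_left (ExteriorAlgebra.ι_add_mul_swap w v)
    rw [mul_assoc, hx, ← mul_assoc, hvw, map_mul, CliffordAlgebra.involute_ι]
    simp [mul_assoc]

theorem involute_of_mem {R M : Type*} [CommRing R] [AddCommGroup M] [Module R M]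
    {q : QuadraticForm R M} {i : ZMod 2} {x : CliffordAlgebra q}
    (hx : x ∈ CliffordAlgebra.evenOdd q i) :
    CliffordAlgebra.involute x = ((-1 : ℤˣ) ^ i) • x := by
  obtain rfl | rfl := (by decide : ∀ z : ZMod 2, z = 0 ∨ z = 1) i
  · simp [CliffordAlgebra.involute_eq_of_mem_even hx]
  · simp [CliffordAlgebra.involute_eq_of_mem_odd hx]

theorem Grassmann.mul_comm_of_mem (r s : ℕ) {R : Type*} [CommRing R] {i j : ZMod 2}
    {f g : Grassmann r s R} (hf : f ∈ CliffordAlgebra.evenOdd 0 i)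
    (hg : g ∈ CliffordAlgebra.evenOdd 0 j) : f * g = ((-1 : ℤˣ) ^ (i * j)) • (g * f) := by
  have key : ∀ f : Grassmann r s R, g * f =
      (if j = 0 then f else CliffordAlgebra.involute f) * g := by
    intro f
    induction f using CliffordAlgebra.left_induction with
    | algebraMap c => simp only [AlgHom.commutes, ite_self, Algebra.commutes]
    | add x y hx hy => rw [mul_add, hx, hy, map_add]; split_ifs <;> rw [add_mul]
    | ι_mul x v hx =>
      rw [← mul_assoc, Grassmann.mul_ι, involute_of_mem hg, mul_smul_comm, smul_mul_assoc,
        mul_assoc, hx, map_mul, CliffordAlgebra.involute_ι]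
      obtain rfl | rfl := (by decide : ∀ z : ZMod 2, z = 0 ∨ z = 1) j
      · simp [mul_assoc]
      · simp [mul_assoc]
  rw [key, involute_of_mem hf]
  obtain rfl | rfl := (by decide : ∀ z : ZMod 2, z = 0 ∨ z = 1) j
  · simp
  · rw [if_neg one_ne_zero, mul_one, smul_mul_assoc, smul_smul, Int.units_mul_self, one_smul]

theorem cliffBasis_mem (r s : ℕ) {K : Type*} [Field K] (h : K) (S : Finset (Gen r s)) :
    cliffBasis r s h S ∈ CliffordAlgebra.evenOdd (cliffForm r s h) (S.card : ZMod 2) :=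
  cliffBasis_apply r s h S ▸ cliffMonomial_mem _ _ _ S

section Quantization

variable (r s : ℕ) {K : Type*} [Field K] [Algebra ℂ K] (h : K)

/-! ### The normal-ordered product on the Grassmann algebra -/

/-- The homomorphism induced by `ℂ → K` from the complex Grassmann algebra to the Grassmann algebra
over `K`. -/
def grassmannExtend (K : Type*) [Field K] [Algebra ℂ K] : Grassmann r s ℂ →ₐ[ℂ] Grassmann r s K :=
  CliffordAlgebra.lift 0
    ⟨(CliffordAlgebra.ι (0 : QuadraticForm K (Gen r s → K))).restrictScalars ℂ ∘ₗ
      (Algebra.linearMap ℂ K).compLeft (Gen r s), fun v => by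
        simp⟩

theorem grassmannExtend_ι (v : Gen r s → ℂ) :
    grassmannExtend r s K (CliffordAlgebra.ι 0 v) =
      CliffordAlgebra.ι 0 (algebraMap ℂ K ∘ v) := by
  rw [grassmannExtend, CliffordAlgebra.lift_ι_apply]
  rfl

theorem grassmannExtend_pderiv (a : Gen r s) (f : Grassmann r s ℂ) :
    grassmannExtend r s K (pderivGrassmann a f) =
      pderivGrassmann a (grassmannExtend r s K f) := by
  induction f using CliffordAlgebra.left_induction with
  | algebraMap c =>
    rw [AlgHom.commutes, IsScalarTower.algebraMap_apply ℂ K (Grassmann r s K), pderivGrassmann,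
      pderivGrassmann,
      CliffordAlgebra.contractLeft_algebraMap, CliffordAlgebra.contractLeft_algebraMap, map_zero]
  | add x y hx hy => simp only [map_add, hx, hy]
  | ι_mul x v hx =>
    rw [pderivGrassmann] at hx ⊢
    rw [pderivGrassmann] at hx ⊢
    rw [CliffordAlgebra.contractLeft_ι_mul, map_sub, map_mul, map_mul, hx, map_smul,
      grassmannExtend_ι, CliffordAlgebra.contractLeft_ι_mul, LinearMap.proj_apply,
      LinearMap.proj_apply, Function.comp_apply, algebraMap_smul]

/-- Quantization is the change of quadratic form from `0` to `cliffForm r s h`. -/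
theorem quantize_eq_changeForm (f : Grassmann r s ℂ) :
    quantize r s h f = CliffordAlgebra.changeForm (cliffBilin_toQuadraticMap r s h)
      (grassmannExtend r s K f) := by
  have : quantize r s h = (CliffordAlgebra.changeForm
      (cliffBilin_toQuadraticMap r s h)).restrictScalars ℂ ∘ₗ
        (grassmannExtend r s K).toLinearMap := by
    refine (grassmannBasis r s ℂ).ext fun S => ?_
    have hS : grassmannExtend r s K (cliffMonomial 0 S) = cliffMonomial 0 S := by
      rw [cliffMonomial, map_list_prod, List.map_map, cliffMonomial]
      congr 2
      ext a
      rw [Function.comp_apply, grassmannExtend_ι]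
      congr 1
      ext b
      simp [Pi.single_apply, apply_ite]
    rw [quantize, Module.Basis.constr_basis, ← cliffBasis_apply, cliffBasis, Module.Basis.map_apply,
      LinearMap.comp_apply, grassmannBasis_apply, grassmannBasis_apply]
    change _ = CliffordAlgebra.changeForm (cliffBilin_toQuadraticMap r s h)
      (grassmannExtend r s K (cliffMonomial 0 S))
    rw [hS]
    rfl
  exact LinearMap.congr_fun this f

/-- The contraction `∑ᵢ ηᵢ(v) ∂/∂ξᵢ + ½ ∑ⱼ θⱼ(v) ∂/∂θⱼ` with the vector `v`: the correction
to the wedge product with `v` in the normal-ordered product. -/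
def wickContract (v : Gen r s → ℂ) : Grassmann r s ℂ →ₗ[ℂ] Grassmann r s ℂ :=
  ∑ i : Fin r, v (.eta i) • pderivGrassmann (.xi i) +
    (2⁻¹ : ℂ) • ∑ j : Fin s, v (.theta j) • pderivGrassmann (.theta j)

/-- Left multiplication by a generator in the Clifford algebra, read off in the Grassmann algebra. -/
theorem ι_mul_quantize (v : Gen r s → ℂ) (g : Grassmann r s ℂ) :
    CliffordAlgebra.ι (cliffForm r s h) (algebraMap ℂ K ∘ v) * quantize r s h g =
      quantize r s h (CliffordAlgebra.ι 0 v * g) + h • quantize r s h (wickContract r s v g) := by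
  have hB : cliffBilin r s h (algebraMap ℂ K ∘ v) =
      h • (∑ i : Fin r, algebraMap ℂ K (v (.eta i)) • (LinearMap.proj (.xi i)) +
        (2⁻¹ : K) • ∑ j : Fin s, algebraMap ℂ K (v (.theta j)) • (LinearMap.proj (.theta j))) := by
    refine LinearMap.ext fun w => ?_
    simp [cliffBilin, Algebra.smul_def]
  have h2 : (2⁻¹ : K) = algebraMap ℂ K 2⁻¹ := by rw [map_inv₀, map_ofNat]
  rw [quantize_eq_changeForm, quantize_eq_changeForm, quantize_eq_changeForm, map_mul,
    grassmannExtend_ι, CliffordAlgebra.changeForm_ι_mul, ← CliffordAlgebra.changeForm_contractLeft,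
    sub_add, eq_comm, sub_eq_self, sub_eq_zero, hB, ← map_smul]
  congr 1
  simp only [wickContract, map_smul, map_add, map_sum, LinearMap.add_apply, LinearMap.smul_apply,
    LinearMap.sum_apply, grassmannExtend_pderiv, h2]
  simp only [algebraMap_smul]
  rfl

/-- The coefficient of `h` in the normal-ordered product of `f` and `g`. -/
def wickProduct (f g : Grassmann r s ℂ) : Grassmann r s ℂ :=
  -(∑ i : Fin r, pderivGrassmann (.eta i) (CliffordAlgebra.involute f) *
      pderivGrassmann (.xi i) g +
    (2⁻¹ : ℂ) • ∑ j : Fin s, pderivGrassmann (.theta j) (CliffordAlgebra.involute f) *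
      pderivGrassmann (.theta j) g)

theorem pderivGrassmann_ι_mul {R : Type*} [CommRing R] (a : Gen r s) (v : Gen r s → R)
    (f : Grassmann r s R) : pderivGrassmann a (CliffordAlgebra.ι 0 v * f) =
      v a • f - CliffordAlgebra.ι 0 v * pderivGrassmann a f :=
  CliffordAlgebra.contractLeft_ι_mul _ _ _

theorem pderivGrassmann_algebraMap {R : Type*} [CommRing R] (a : Gen r s) (c : R) :
    pderivGrassmann a (algebraMap R (Grassmann r s R) c) = 0 :=
  CliffordAlgebra.contractLeft_algebraMap 0 _ _

/-- The super Leibniz rule for the partial derivatives. -/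
theorem pderivGrassmann_mul {R : Type*} [CommRing R] (a : Gen r s) (f g : Grassmann r s R) :
    pderivGrassmann a (f * g) =
      pderivGrassmann a f * g + CliffordAlgebra.involute f * pderivGrassmann a g := by
  induction f using CliffordAlgebra.left_induction with
  | algebraMap c =>
    rw [pderivGrassmann_algebraMap, AlgHom.commutes, ← Algebra.smul_def, ← Algebra.smul_def,
      map_smul, zero_mul, zero_add]
  | add x y hx hy => simp only [add_mul, map_add, hx, hy]; abel
  | ι_mul x v hx =>
    rw [mul_assoc, pderivGrassmann_ι_mul, hx, pderivGrassmann_ι_mul, map_mul,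
      CliffordAlgebra.involute_ι]
    simp only [sub_mul, mul_add, smul_mul_assoc, neg_mul, mul_assoc]
    abel

theorem wickContract_mul (v : Gen r s → ℂ) (f g : Grassmann r s ℂ) :
    wickContract r s v (f * g) =
      wickContract r s v f * g + CliffordAlgebra.involute f * wickContract r s v g := by
  simp only [wickContract, LinearMap.add_apply, LinearMap.smul_apply, LinearMap.sum_apply,
    pderivGrassmann_mul, smul_add, Finset.sum_add_distrib, add_mul, mul_add, Finset.sum_mul,
    Finset.mul_sum, smul_mul_assoc, mul_smul_comm]
  abel

theorem wickProduct_ι_mul (v : Gen r s → ℂ) (f g : Grassmann r s ℂ) :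
    wickProduct r s (CliffordAlgebra.ι 0 v * f) g =
      CliffordAlgebra.ι 0 v * wickProduct r s f g +
        CliffordAlgebra.involute f * wickContract r s v g := by
  simp only [wickProduct, wickContract, map_mul, CliffordAlgebra.involute_ι, neg_mul, map_neg,
    pderivGrassmann_ι_mul, LinearMap.add_apply, LinearMap.smul_apply,
    LinearMap.sum_apply, mul_neg, mul_add, Finset.mul_sum, mul_smul_comm,
    sub_mul, smul_mul_assoc, neg_sub, Finset.sum_sub_distrib, smul_sub, mul_assoc]
  abel

theorem wickProduct_algebraMap (c : ℂ) (g : Grassmann r s ℂ) :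
    wickProduct r s (algebraMap ℂ _ c) g = 0 := by
  simp [wickProduct, pderivGrassmann_algebraMap]

theorem wickProduct_add (f₁ f₂ g : Grassmann r s ℂ) :
    wickProduct r s (f₁ + f₂) g = wickProduct r s f₁ g + wickProduct r s f₂ g := by
  simp only [wickProduct, map_add, add_mul, Finset.sum_add_distrib, smul_add]
  abel

/-- The first-order term of the commutator of the normal-ordered product is the Poisson bracket,
up to sign. -/
theorem wickProduct_sub_swap {i j : ZMod 2} {f g : Grassmann r s ℂ}
    (hf : f ∈ CliffordAlgebra.evenOdd 0 i) (hg : g ∈ CliffordAlgebra.evenOdd 0 j) :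
    wickProduct r s f g - ((-1 : ℤˣ) ^ (i * j)) • wickProduct r s g f =
      -poissonBracket r s ℂ f g := by
  have key : ∀ a b : Gen r s, ((-1 : ℤˣ) ^ (i * j)) •
      (pderivGrassmann a (CliffordAlgebra.involute g) * pderivGrassmann b f) =
      -(pderivGrassmann b (CliffordAlgebra.involute f) * pderivGrassmann a g) := by
    intro a b
    rw [involute_of_mem hf, involute_of_mem hg, Units.smul_def ((-1 : ℤˣ) ^ j),
      Units.smul_def ((-1 : ℤˣ) ^ i), map_zsmul, map_zsmul, ← Units.smul_def, ← Units.smul_def,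
      smul_mul_assoc, smul_mul_assoc, Grassmann.mul_comm_of_mem r s
        (pderivGrassmann_mem r s a j g hg) (pderivGrassmann_mem r s b i f hf), smul_smul, smul_smul]
    obtain rfl | rfl := (by decide : ∀ z : ZMod 2, z = 0 ∨ z = 1) i <;>
      obtain rfl | rfl := (by decide : ∀ z : ZMod 2, z = 0 ∨ z = 1) j <;>
      simp [(by decide : (1 + 1 : ZMod 2) = 0)]
  simp only [wickProduct, smul_neg, smul_add, Finset.smul_sum,
    smul_comm ((-1 : ℤˣ) ^ (i * j)) (2⁻¹ : ℂ), key]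
  simp only [poissonBracket, LinearMap.comp_apply, LinearMap.add_apply, LinearMap.sum_apply,
    LinearMap.compl₁₂_apply, LinearMap.mul_apply', AlgHom.toLinearMap_apply, Finset.sum_neg_distrib,
    Finset.sum_add_distrib]
  -- Each `θ`-term of the bracket arises twice with the factor `½`, once from each order of `f`, `g`.
  have half : ∀ x : Grassmann r s ℂ, x = (2⁻¹ : ℂ) • x + (2⁻¹ : ℂ) • x := by
    intro x
    rw [← add_smul]
    norm_num
  rw [half (∑ j : Fin s, pderivGrassmann (.theta j) (CliffordAlgebra.involute f) * _),
    Finset.smul_sum]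
  abel

/-- Quantization preserves parity. -/
theorem quantize_mem {i : ZMod 2} {f : Grassmann r s ℂ} (hf : f ∈ CliffordAlgebra.evenOdd 0 i) :
    quantize r s h f ∈ CliffordAlgebra.evenOdd (cliffForm r s h) i := by
  have : quantize r s h ∘ₗ parityProj (CliffordAlgebra.evenOdd 0) i =
      (parityProj (CliffordAlgebra.evenOdd (cliffForm r s h)) i).restrictScalars ℂ ∘ₗ
        quantize r s h := by
    refine (grassmannBasis r s ℂ).ext fun S => ?_
    rw [LinearMap.comp_apply, LinearMap.comp_apply, LinearMap.restrictScalars_apply,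
      parityProj_of_mem _ (grassmannBasis_apply r s ℂ S ▸ cliffMonomial_mem _ _ 0 S), apply_ite
        (quantize r s h), map_zero, quantize, Module.Basis.constr_basis,
      parityProj_of_mem _ (cliffMonomial_mem _ _ _ S)]
  have e := LinearMap.congr_fun this f
  rw [LinearMap.comp_apply, parityProj_of_mem _ hf, if_pos rfl] at e
  rw [e]
  exact SetLike.coe_mem (DirectSum.decompose (CliffordAlgebra.evenOdd (cliffForm r s h))
    (quantize r s h f) i)

theorem quantizePoly_coordFn (α : Module.Dual ℂ (Grassmann r s ℂ)) :
    quantizePoly r s h (coordFn _ α) = coordFn _ (quantizeDual r s h α) :=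
  SuperPoly.lift_coordFn _ ((coordFn _).restrictScalars ℂ ∘ₗ quantizeDual r s h)
    (fun hα hβ => coordFn_swap _ (quantizeDual_mem r s h hα) (quantizeDual_mem r s h hβ)) α

end Quantization

/-! ### Lattices over a subalgebra of the ground field -/

section Lattice

variable {K M N : Type*} [Field K] [Algebra ℂ K] [AddCommGroup M] [Module ℂ M] [AddCommGroup N]
  [Module ℂ N] [Module K N] (A : Subalgebra ℂ K) (Q : M →ₗ[ℂ] N)

/-- The `A`-lattice spanned by the image of a complex vector space `M` in a vector space `N` over
`K`. For `A = ℂ[[t]] ⊆ K = ℂ((t))` these are the elements that are regular at `t = 0`. -/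
def imageLattice : AddSubgroup N :=
  AddSubgroup.closure {x | ∃ a ∈ A, ∃ g : M, x = a • Q g}

variable {A}

theorem smul_image_mem_imageLattice {a : K} (ha : a ∈ A) (g : M) : a • Q g ∈ imageLattice A Q :=
  AddSubgroup.subset_closure ⟨a, ha, g, rfl⟩

variable {Q}

theorem smul_mem_imageLattice {a : K} (ha : a ∈ A) {x : N} (hx : x ∈ imageLattice A Q) :
    a • x ∈ imageLattice A Q := by
  induction hx using AddSubgroup.closure_induction with
  | mem x hx =>
    obtain ⟨b, hb, g, rfl⟩ := hx
    rw [smul_smul]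
    exact smul_image_mem_imageLattice Q (mul_mem ha hb) g
  | zero => rw [smul_zero]; exact zero_mem _
  | add x y _ _ hx hy => rw [smul_add]; exact add_mem hx hy
  | neg x _ hx => rw [smul_neg]; exact neg_mem hx

variable (A Q)

theorem image_mem_imageLattice (g : M) : Q g ∈ imageLattice A Q := by
  have := smul_image_mem_imageLattice Q (one_mem A) g
  rwa [one_smul] at this

variable {A Q}

theorem units_smul_mem_imageLattice (u : ℤˣ) {x : N} (hx : x ∈ imageLattice A Q) :
    u • x ∈ imageLattice A Q :=
  (imageLattice A Q).zsmul_mem hx u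

theorem map_mem_imageLattice (T : N →ₗ[K] N) (hT : ∀ g, T (Q g) ∈ imageLattice A Q) {x : N}
    (hx : x ∈ imageLattice A Q) : T x ∈ imageLattice A Q := by
  induction hx using AddSubgroup.closure_induction with
  | mem x hx =>
    obtain ⟨b, hb, g, rfl⟩ := hx
    rw [map_smul]
    exact smul_mem_imageLattice hb (hT g)
  | zero => rw [map_zero]; exact zero_mem _
  | add x y _ _ hx hy => rw [map_add]; exact add_mem hx hy
  | neg x _ hx => rw [map_neg]; exact neg_mem hx

end Lattice

/-! ### The commutator on the Clifford algebra to first order in `ħ` -/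

section Commutator

variable {r s : ℕ} {K : Type*} [Field K] [Algebra ℂ K] {h : K} {A : Subalgebra ℂ K}

theorem ι_mul_mem_imageLattice (hA : h ∈ A) (v : Gen r s → ℂ) {x : Cliff r s h}
    (hx : x ∈ imageLattice A (quantize r s h)) :
    CliffordAlgebra.ι (cliffForm r s h) (algebraMap ℂ K ∘ v) * x ∈
      imageLattice A (quantize r s h) := by
  refine map_mem_imageLattice (LinearMap.mulLeft K _) (fun g => ?_) hx
  rw [LinearMap.mulLeft_apply, ι_mul_quantize]
  exact add_mem (image_mem_imageLattice _ _ _) (smul_image_mem_imageLattice _ hA _)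

theorem quantize_mul_mem_imageLattice (hA : h ∈ A) (f g : Grassmann r s ℂ) :
    quantize r s h f * quantize r s h g ∈ imageLattice A (quantize r s h) := by
  -- The first factor is expanded into products of generators: an induction on `f` by means of
  -- `quantize_ι_mul` would require the claim for the contraction of `f` as well.
  have key : ∀ l : List (Gen r s), (l.map fun a =>
      CliffordAlgebra.ι (cliffForm r s h) (Pi.single a 1)).prod * quantize r s h g ∈
        imageLattice A (quantize r s h) := by
    intro l
    induction l with
    | nil => simpa using image_mem_imageLattice A (quantize r s h) g
    | cons a l ih =>
      rw [List.map_cons, List.prod_cons, mul_assoc]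
      convert ι_mul_mem_imageLattice hA (Pi.single a 1) ih using 3
      ext b : 1
      simp [Pi.single_apply, apply_ite]
  rw [← (grassmannBasis r s ℂ).sum_repr f, map_sum, Finset.sum_mul]
  refine sum_mem fun S _ => ?_
  rw [map_smul, ← algebraMap_smul K, smul_mul_assoc, quantize, Module.Basis.constr_basis]
  exact smul_mem_imageLattice (A.algebraMap_mem _) (key _)

theorem quantize_one : quantize r s h 1 = 1 := by
  rw [quantize_eq_changeForm, map_one, CliffordAlgebra.changeForm_one]

theorem quantize_algebraMap_mul (c : ℂ) (g : Grassmann r s ℂ) :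
    quantize r s h (algebraMap ℂ _ c) * quantize r s h g =
      quantize r s h (algebraMap ℂ _ c * g) := by
  rw [← Algebra.smul_def, map_smul, Algebra.algebraMap_eq_smul_one, map_smul, quantize_one,
    smul_mul_assoc, one_mul]

theorem quantize_ι_mul (v : Gen r s → ℂ) (f : Grassmann r s ℂ) :
    quantize r s h (CliffordAlgebra.ι 0 v * f) =
      CliffordAlgebra.ι (cliffForm r s h) (algebraMap ℂ K ∘ v) * quantize r s h f -
        h • quantize r s h (wickContract r s v f) :=
  eq_sub_of_add_eq (ι_mul_quantize r s h v f).symm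

/-- The product of the Clifford algebra is, to zeroth order in `h`, the exterior product. -/
theorem exists_quantize_mul_sub_eq (hA : h ∈ A) (f g : Grassmann r s ℂ) :
    ∃ x ∈ imageLattice A (quantize r s h),
      quantize r s h f * quantize r s h g - quantize r s h (f * g) = h • x := by
  induction f using CliffordAlgebra.left_induction with
  | algebraMap c =>
    exact ⟨0, zero_mem _, by rw [quantize_algebraMap_mul, sub_self, smul_zero]⟩
  | add f₁ f₂ h₁ h₂ =>
    obtain ⟨x, hx, ex⟩ := h₁
    obtain ⟨y, hy, ey⟩ := h₂
    refine ⟨x + y, add_mem hx hy, ?_⟩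
    rw [smul_add, ← ex, ← ey, map_add, add_mul, add_mul, map_add, add_sub_add_comm]
  | ι_mul f v ih =>
    obtain ⟨x, hx, ex⟩ := ih
    refine ⟨CliffordAlgebra.ι (cliffForm r s h) (algebraMap ℂ K ∘ v) * x +
      quantize r s h (wickContract r s v (f * g)) -
        quantize r s h (wickContract r s v f) * quantize r s h g,
      sub_mem (add_mem (ι_mul_mem_imageLattice hA v hx) (image_mem_imageLattice _ _ _))
        (quantize_mul_mem_imageLattice hA _ _), ?_⟩
    rw [smul_sub, smul_add, ← mul_smul_comm, ← ex, mul_assoc, quantize_ι_mul, quantize_ι_mul,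
      sub_mul, mul_sub, mul_assoc, smul_mul_assoc]
    abel

/-- The product of the Clifford algebra to first order in `h`. -/
theorem exists_quantize_mul_sub_sub_eq (hA : h ∈ A) (f g : Grassmann r s ℂ) :
    ∃ x ∈ imageLattice A (quantize r s h),
      quantize r s h f * quantize r s h g - quantize r s h (f * g) -
        h • quantize r s h (wickProduct r s f g) = h ^ 2 • x := by
  induction f using CliffordAlgebra.left_induction with
  | algebraMap c =>
    exact ⟨0, zero_mem _, by rw [quantize_algebraMap_mul, sub_self, wickProduct_algebraMap, map_zero,
      smul_zero, smul_zero, sub_zero]⟩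
  | add f₁ f₂ h₁ h₂ =>
    obtain ⟨x, hx, ex⟩ := h₁
    obtain ⟨y, hy, ey⟩ := h₂
    refine ⟨x + y, add_mem hx hy, ?_⟩
    rw [smul_add, ← ex, ← ey, map_add, add_mul, add_mul, map_add, wickProduct_add, map_add, smul_add]
    abel
  | ι_mul f v ih =>
    obtain ⟨x, hx, ex⟩ := ih
    obtain ⟨y, hy, ey⟩ := exists_quantize_mul_sub_eq hA (wickContract r s v f) g
    refine ⟨CliffordAlgebra.ι (cliffForm r s h) (algebraMap ℂ K ∘ v) * x +
      quantize r s h (wickContract r s v (wickProduct r s f g)) - y,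
      sub_mem (add_mem (ι_mul_mem_imageLattice hA v hx) (image_mem_imageLattice _ _ _)) hy, ?_⟩
    rw [smul_sub, smul_add, ← mul_smul_comm, ← ex, pow_two, mul_smul h h y, ← ey, mul_assoc,
      quantize_ι_mul, quantize_ι_mul, wickProduct_ι_mul, map_add, quantize_ι_mul, wickContract_mul,
      map_add]
    simp only [sub_mul, mul_sub, mul_assoc, smul_mul_assoc, smul_sub, smul_add, mul_smul_comm,
      mul_smul]
    abel

/-- The supercommutator of the Clifford algebra is, to first order in `h`, minus the Poisson
bracket. -/
theorem exists_superCommutator_quantize_add_eq (hA : h ∈ A) {i j : ZMod 2} {f g : Grassmann r s ℂ}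
    (hf : f ∈ CliffordAlgebra.evenOdd 0 i) (hg : g ∈ CliffordAlgebra.evenOdd 0 j) :
    ∃ x ∈ imageLattice A (quantize r s h),
      superCommutator (CliffordAlgebra.evenOdd (cliffForm r s h))
          (quantize r s h f) (quantize r s h g) +
        h • quantize r s h (poissonBracket r s ℂ f g) = h ^ 2 • x := by
  obtain ⟨x, hx, ex⟩ := exists_quantize_mul_sub_sub_eq hA f g
  obtain ⟨y, hy, ey⟩ := exists_quantize_mul_sub_sub_eq hA g f
  refine ⟨x - ((-1 : ℤˣ) ^ (i * j)) • y, sub_mem hx (units_smul_mem_imageLattice _ hy), ?_⟩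
  rw [smul_sub, smul_comm (h ^ 2), ← ex, ← ey,
    superCommutator_of_mem _ (quantize_mem r s _ hf) (quantize_mem r s _ hg),
    ← neg_neg (poissonBracket r s ℂ f g), ← wickProduct_sub_swap r s hf hg,
    Grassmann.mul_comm_of_mem r s hf hg]
  simp only [Units.smul_def, map_neg, map_sub, map_zsmul, smul_sub, smul_neg,
    smul_comm h (_ : ℤ)]
  abel

theorem quantizeDual_mem_of_mem_imageLattice (α : Module.Dual ℂ (Grassmann r s ℂ))
    {x : Cliff r s h} (hx : x ∈ imageLattice A (quantize r s h)) :
    quantizeDual r s h α x ∈ A := by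
  induction hx using AddSubgroup.closure_induction with
  | mem x hx =>
    obtain ⟨a, ha, g, rfl⟩ := hx
    rw [map_smul, quantizeDual_quantize, smul_eq_mul]
    exact mul_mem ha (A.algebraMap_mem _)
  | zero => rw [map_zero]; exact zero_mem _
  | add x y _ _ hx hy => rw [map_add]; exact add_mem hx hy
  | neg x _ hx => rw [map_neg]; exact neg_mem hx

end Commutator

/-! ### Homogeneous linear functionals -/

section Dual

variable {R V : Type*} [CommRing R] [AddCommGroup V] [Module R V]

theorem comp_parityProj_mem_dualPart (𝒜 : ZMod 2 → Submodule R V) [DirectSum.Decomposition 𝒜]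
    (α : Module.Dual R V) (i : ZMod 2) : α ∘ₗ parityProj 𝒜 i ∈ dualPart 𝒜 i := by
  refine (Submodule.mem_dualAnnihilator _).2 fun v hv => ?_
  rw [LinearMap.comp_apply, parityProj_of_mem 𝒜 hv,
    if_neg ((by decide : ∀ i : ZMod 2, i ≠ i + 1) i), map_zero]

theorem sum_comp_parityProj (𝒜 : ZMod 2 → Submodule R V) [DirectSum.Decomposition 𝒜]
    (α : Module.Dual R V) : ∑ i, α ∘ₗ parityProj 𝒜 i = α := by
  refine dual_ext_of_mem 𝒜 fun j v hv => ?_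
  simp [LinearMap.sum_apply, parityProj_of_mem 𝒜 hv, apply_ite α]

/-- Polynomials are generated by the homogeneous linear functionals. -/
theorem SuperPoly.induction_homogeneous (𝒜 : ZMod 2 → Submodule R V) [DirectSum.Decomposition 𝒜]
    {C : SuperPoly 𝒜 → Prop} (hone : C 1) (hadd : ∀ F G, C F → C G → C (F + G))
    (hsmul : ∀ (c : R) F, C F → C (c • F))
    (hmul : ∀ i, ∀ α ∈ dualPart 𝒜 i, ∀ F, C F → C (coordFn 𝒜 α * F)) (F : SuperPoly 𝒜) : C F := by
  refine SuperPoly.induction 𝒜 hone hadd hsmul (fun α F hF => ?_) F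
  rw [← sum_comp_parityProj 𝒜 α, map_sum, Finset.sum_mul]
  refine Finset.sum_induction _ C hadd ?_ fun i _ =>
    hmul i _ (comp_parityProj_mem_dualPart 𝒜 α i) F hF
  rw [← zero_smul R 1]
  exact hsmul 0 1 hone

theorem superDer_one (𝒜 : ZMod 2 → Submodule R V) [DirectSum.Decomposition 𝒜] (i : ZMod 2)
    (L : V →ₗ[R] V) (hL : ∀ j, ∀ v ∈ 𝒜 j, L v ∈ 𝒜 (i + j)) : superDer 𝒜 i L hL 1 = 0 := by
  simp [superDer]

/-- The coordinate functions with respect to a basis of homogeneous vectors are homogeneous. -/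
theorem coord_mem_dualPart (𝒜 : ZMod 2 → Submodule R V) [DirectSum.Decomposition 𝒜] {ι : Type*}
    (b : Module.Basis ι R V) (p : ι → ZMod 2) (hb : ∀ S, b S ∈ 𝒜 (p S)) (S : ι) :
    b.coord S ∈ dualPart 𝒜 (p S) := by
  have : b.coord S ∘ₗ parityProj 𝒜 (p S) = b.coord S := by
    refine b.ext fun T => ?_
    rw [LinearMap.comp_apply, parityProj_of_mem 𝒜 (hb T)]
    split_ifs with hT
    · rfl
    · have hTS : T ≠ S := fun h => hT (h ▸ rfl)
      simp [Finsupp.single_eq_of_ne' hTS]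
  rw [← this]
  exact comp_parityProj_mem_dualPart 𝒜 _ _

end Dual

section Polynomials

variable {r s : ℕ} {K : Type*} [Field K] [Algebra ℂ K] {h : K} {A : Subalgebra ℂ K}

/-- The coordinate dual to a monomial of the Grassmann algebra, as a polynomial. -/
def monomialCoord (S : Finset (Gen r s)) : PoPoly r s :=
  coordFn _ ((grassmannBasis r s ℂ).coord S)

theorem monomialCoord_swap (S T : Finset (Gen r s)) :
    monomialCoord S * monomialCoord T =
      ((-1 : ℤˣ) ^ ((S.card : ZMod 2) * (T.card : ZMod 2))) •
        (monomialCoord T * monomialCoord S) := by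
  have hb : ∀ S : Finset (Gen r s), (grassmannBasis r s ℂ).coord S ∈
      dualPart (CliffordAlgebra.evenOdd 0) (S.card : ZMod 2) :=
    coord_mem_dualPart _ _ _ fun S => grassmannBasis_apply r s ℂ S ▸ cliffMonomial_mem _ _ 0 S
  exact coordFn_swap _ (hb S) (hb T)

/-! ### Coefficients of polynomials on the Clifford algebra -/

open scoped TensorProduct

variable (r s h) in
/-- The functional `α` on the Clifford algebra, as a linear combination over `K` of the coordinates
of the Grassmann algebra. -/
def dequantizeDual : Module.Dual K (Cliff r s h) →ₗ[K] K ⊗[ℂ] PoPoly r s :=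
  ∑ S : Finset (Gen r s), (LinearMap.toSpanSingleton K (K ⊗[ℂ] PoPoly r s)
    (1 ⊗ₜ monomialCoord S)) ∘ₗ Module.Dual.eval K (Cliff r s h) (cliffBasis r s h S)

theorem dequantizeDual_apply (α : Module.Dual K (Cliff r s h)) :
    dequantizeDual r s h α = ∑ S, α (cliffBasis r s h S) ⊗ₜ[ℂ] monomialCoord S := by
  simp [dequantizeDual, LinearMap.sum_apply, TensorProduct.smul_tmul']

/-- The coordinates of the Clifford algebra supercommute after dequantization. -/
theorem dequantizeDual_swap {i j : ZMod 2} {α β : Module.Dual K (Cliff r s h)}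
    (hα : α ∈ dualPart (CliffordAlgebra.evenOdd (cliffForm r s h)) i)
    (hβ : β ∈ dualPart (CliffordAlgebra.evenOdd (cliffForm r s h)) j) :
    dequantizeDual r s h α * dequantizeDual r s h β =
      ((-1 : ℤˣ) ^ (i * j)) • (dequantizeDual r s h β * dequantizeDual r s h α) := by
  rw [dequantizeDual_apply, dequantizeDual_apply, Finset.sum_mul_sum, Finset.sum_mul_sum,
    Finset.sum_comm, Finset.smul_sum]
  refine Finset.sum_congr rfl fun T _ => ?_
  rw [Finset.smul_sum]
  refine Finset.sum_congr rfl fun S _ => ?_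
  rw [Algebra.TensorProduct.tmul_mul_tmul, Algebra.TensorProduct.tmul_mul_tmul,
    monomialCoord_swap S T, mul_comm (β _)]
  by_cases hS : (S.card : ZMod 2) = i
  · by_cases hT : (T.card : ZMod 2) = j
    · rw [hS, hT, Units.smul_def, Units.smul_def, ← TensorProduct.tmul_smul]
    · rw [dualPart_apply_of_mem _ hβ (cliffBasis_mem r s h T) hT]
      simp [Units.smul_def]
  · rw [dualPart_apply_of_mem _ hα (cliffBasis_mem r s h S) hS]
    simp [Units.smul_def]

variable (r s h) in
/-- The inverse of quantization: polynomials on the Clifford algebra are polynomials on the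
Grassmann algebra with coefficients extended to `K`. -/
def dequantizePoly :
    SuperPoly (CliffordAlgebra.evenOdd (cliffForm r s h)) →ₐ[K] K ⊗[ℂ] PoPoly r s :=
  SuperPoly.lift _ (dequantizeDual r s h) fun hα hβ => dequantizeDual_swap hα hβ

theorem dequantizePoly_quantizePoly (G : PoPoly r s) :
    dequantizePoly r s h (quantizePoly r s h G) = 1 ⊗ₜ[ℂ] G := by
  induction G using SuperPoly.induction with
  | hone => rw [map_one, map_one]; rfl
  | hadd F G hF hG => rw [map_add, map_add, hF, hG, TensorProduct.tmul_add]
  | hsmul c F hF =>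
    rw [map_smul, ← algebraMap_smul K, map_smul, hF, TensorProduct.tmul_smul, algebraMap_smul]
  | hmul α F hF =>
    rw [map_mul, map_mul, hF, quantizePoly_coordFn]
    have e : dequantizePoly r s h (coordFn _ (quantizeDual r s h α)) =
        (1 : K) ⊗ₜ[ℂ] coordFn _ α := by
      have hα : α = ∑ S, α (grassmannBasis r s ℂ S) • (grassmannBasis r s ℂ).coord S := by
        refine (grassmannBasis r s ℂ).ext fun S => ?_
        simp
      rw [dequantizePoly, SuperPoly.lift_coordFn _ _ (fun hα hβ => dequantizeDual_swap hα hβ),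
        dequantizeDual_apply]
      conv_rhs => rw [hα, map_sum, TensorProduct.tmul_sum]
      refine Finset.sum_congr rfl fun S _ => ?_
      rw [cliffBasis_apply, quantizeDual_monomial, map_smul, TensorProduct.tmul_smul,
        TensorProduct.smul_tmul', Algebra.algebraMap_eq_smul_one, grassmannBasis_apply]
      rfl
    rw [e, Algebra.TensorProduct.tmul_mul_tmul, one_mul]

/-- The polynomial on the Grassmann algebra obtained by applying a `ℂ`-linear functional on `K` to
the coefficients of a polynomial on the Clifford algebra. -/
def coeffPoly (l : K →ₗ[ℂ] ℂ) (F : SuperPoly (CliffordAlgebra.evenOdd (cliffForm r s h))) :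
    PoPoly r s :=
  TensorProduct.lid ℂ (PoPoly r s) (LinearMap.rTensor (PoPoly r s) l (dequantizePoly r s h F))

theorem coeffPoly_add (l : K →ₗ[ℂ] ℂ)
    (F G : SuperPoly (CliffordAlgebra.evenOdd (cliffForm r s h))) :
    coeffPoly l (F + G) = coeffPoly l F + coeffPoly l G := by
  simp only [coeffPoly, map_add]

theorem coeffPoly_zero (l : K →ₗ[ℂ] ℂ) :
    coeffPoly l (0 : SuperPoly (CliffordAlgebra.evenOdd (cliffForm r s h))) = 0 := by
  simp only [coeffPoly, map_zero]

theorem coeffPoly_neg (l : K →ₗ[ℂ] ℂ)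
    (F : SuperPoly (CliffordAlgebra.evenOdd (cliffForm r s h))) :
    coeffPoly l (-F) = -coeffPoly l F := by
  simp only [coeffPoly, map_neg]

theorem coeffPoly_smul_quantizePoly (l : K →ₗ[ℂ] ℂ) (c : K) (G : PoPoly r s) :
    coeffPoly l (c • quantizePoly r s h G) = l c • G := by
  rw [coeffPoly, map_smul, dequantizePoly_quantizePoly, TensorProduct.smul_tmul', smul_eq_mul,
    mul_one, LinearMap.rTensor_tmul, TensorProduct.lid_tmul]

theorem coeffPoly_smul_eq_zero (l : K →ₗ[ℂ] ℂ) {c : K} (hc : ∀ a ∈ A, l (c * a) = 0)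
    {F : SuperPoly (CliffordAlgebra.evenOdd (cliffForm r s h))}
    (hF : F ∈ imageLattice A (quantizePoly r s h).toLinearMap) : coeffPoly l (c • F) = 0 := by
  induction hF using AddSubgroup.closure_induction with
  | mem x hx =>
    obtain ⟨a, ha, g, rfl⟩ := hx
    rw [smul_smul, AlgHom.toLinearMap_apply, coeffPoly_smul_quantizePoly, hc a ha, zero_smul]
  | zero => rw [smul_zero, coeffPoly_zero]
  | add x y _ _ hx hy => rw [smul_add, coeffPoly_add, hx, hy, add_zero]
  | neg x _ hx => rw [smul_neg, coeffPoly_neg, hx, neg_zero]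

/-! ### The coadjoint action to first order in `ħ` -/

theorem mul_quantizePoly_mem_imageLattice
    {F : SuperPoly (CliffordAlgebra.evenOdd (cliffForm r s h))}
    (hF : F ∈ imageLattice A (quantizePoly r s h).toLinearMap) (P : PoPoly r s) :
    F * quantizePoly r s h P ∈ imageLattice A (quantizePoly r s h).toLinearMap := by
  refine map_mem_imageLattice (LinearMap.mulRight K (quantizePoly r s h P)) (fun G => ?_) hF
  rw [LinearMap.mulRight_apply, AlgHom.toLinearMap_apply, ← map_mul]
  exact image_mem_imageLattice A (quantizePoly r s h).toLinearMap _

theorem quantizePoly_mul_mem_imageLattice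
    {F : SuperPoly (CliffordAlgebra.evenOdd (cliffForm r s h))}
    (hF : F ∈ imageLattice A (quantizePoly r s h).toLinearMap) (P : PoPoly r s) :
    quantizePoly r s h P * F ∈ imageLattice A (quantizePoly r s h).toLinearMap := by
  refine map_mem_imageLattice (LinearMap.mulLeft K (quantizePoly r s h P)) (fun G => ?_) hF
  rw [LinearMap.mulLeft_apply, AlgHom.toLinearMap_apply, ← map_mul]
  exact image_mem_imageLattice A (quantizePoly r s h).toLinearMap _

/-- A functional on the Clifford algebra whose values on the monomials are in `c A` is `c` times an
element of the lattice of polynomials. -/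
theorem exists_coordFn_eq_smul {c : K} (β : Module.Dual K (Cliff r s h))
    (hβ : ∀ S, ∃ a ∈ A, β (cliffBasis r s h S) = c * a) :
    ∃ y ∈ imageLattice A (quantizePoly r s h).toLinearMap, coordFn _ β = c • y := by
  choose a ha e using hβ
  refine ⟨∑ S, a S • quantizePoly r s h (monomialCoord S), sum_mem fun S _ =>
    smul_image_mem_imageLattice (quantizePoly r s h).toLinearMap (ha S) _, ?_⟩
  have hβ' : β = c • ∑ S, a S • quantizeDual r s h ((grassmannBasis r s ℂ).coord S) := by
    refine (cliffBasis r s h).ext fun S => ?_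
    have hS : ∀ T, quantizeDual r s h ((grassmannBasis r s ℂ).coord T) (cliffBasis r s h S) =
        if T = S then 1 else 0 := by
      intro T
      rw [cliffBasis_apply, quantizeDual_monomial, ← grassmannBasis_apply, Module.Basis.coord_apply,
        Module.Basis.repr_self, Finsupp.single_apply, apply_ite (algebraMap ℂ K), map_one, map_zero]
      simp only [eq_comm]
    rw [e, LinearMap.smul_apply, LinearMap.sum_apply]
    simp [hS]
  rw [hβ']
  simp only [map_smul, map_sum, monomialCoord, quantizePoly_coordFn]

/-- The coadjoint action of `f` on linear functionals is, to first order in `h`, minus the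
coadjoint action with respect to the Poisson bracket. -/
theorem exists_dualAct_add_eq (hA : h ∈ A) {i j : ZMod 2} {f : Grassmann r s ℂ}
    (hf : f ∈ CliffordAlgebra.evenOdd 0 i) {α : Module.Dual ℂ (Grassmann r s ℂ)}
    (hα : α ∈ dualPart (CliffordAlgebra.evenOdd 0) j) :
    ∃ y ∈ imageLattice A (quantizePoly r s h).toLinearMap,
      coordFn _ (dualAct (CliffordAlgebra.evenOdd (cliffForm r s h)) i
          (superCommutator (CliffordAlgebra.evenOdd (cliffForm r s h)) (quantize r s h f))
          (quantizeDual r s h α)) +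
        h • coordFn _ (quantizeDual r s h
          (dualAct (CliffordAlgebra.evenOdd 0) i (poissonBracket r s ℂ f) α)) = h ^ 2 • y := by
  rw [← map_smul, ← map_add]
  refine exists_coordFn_eq_smul _ fun S => ?_
  obtain ⟨x, hx, ex⟩ := exists_superCommutator_quantize_add_eq hA hf
    (cliffMonomial_mem r s (0 : QuadraticForm ℂ (Gen r s → ℂ)) S)
  have hS : quantize r s h (cliffMonomial 0 S) = cliffBasis r s h S := by
    rw [← grassmannBasis_apply, quantize, Module.Basis.constr_basis, cliffBasis_apply]
  refine ⟨-(((-1 : ℤˣ) ^ (i * j)) • quantizeDual r s h α x), neg_mem ?_, ?_⟩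
  · rw [Units.smul_def]
    exact zsmul_mem (quantizeDual_mem_of_mem_imageLattice α hx) _
  · have e := congrArg (quantizeDual r s h α) ex
    rw [map_add, map_smul, map_smul, quantizeDual_quantize, smul_eq_mul, smul_eq_mul] at e
    rw [LinearMap.add_apply, LinearMap.smul_apply, dualAct_apply_of_mem _ i _
      (quantizeDual_mem r s h hα), ← hS, quantizeDual_quantize, dualAct_apply_of_mem _ i _ hα]
    obtain hu | hu := Int.units_eq_one_or ((-1 : ℤˣ) ^ (i * j))
    · rw [hu, one_smul, one_smul, one_smul, map_neg, smul_eq_mul]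
      linear_combination -e
    · rw [hu]
      simp only [Units.smul_def, Units.val_neg, Units.val_one, neg_smul, one_smul, neg_neg,
        smul_eq_mul]
      linear_combination e

/-- The coadjoint action of `f` on polynomials is, to first order in `h`, minus the coadjoint
action with respect to the Poisson bracket. -/
theorem exists_superDer_quantizePoly_add_eq (hA : h ∈ A) {i : ZMod 2} {f : Grassmann r s ℂ}
    (hf : f ∈ CliffordAlgebra.evenOdd 0 i) (G : PoPoly r s) :
    ∃ y ∈ imageLattice A (quantizePoly r s h).toLinearMap,
      superDer (CliffordAlgebra.evenOdd (cliffForm r s h)) i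
          (superCommutator (CliffordAlgebra.evenOdd (cliffForm r s h)) (quantize r s h f))
          (fun j => superCommutator_mem _ i j _ (quantize_mem r s h hf)) (quantizePoly r s h G) +
        h • quantizePoly r s h (superDer (CliffordAlgebra.evenOdd 0) i (poissonBracket r s ℂ f)
          (fun j => poissonBracket_mem r s ℂ i j f hf) G) = h ^ 2 • y := by
  induction G using SuperPoly.induction_homogeneous with
  | hone => exact ⟨0, zero_mem _, by simp [superDer_one]⟩
  | hadd F G hF hG =>
    obtain ⟨x, hx, ex⟩ := hF
    obtain ⟨y, hy, ey⟩ := hG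
    refine ⟨x + y, add_mem hx hy, ?_⟩
    rw [smul_add, ← ex, ← ey]
    simp only [map_add, smul_add]
    abel
  | hsmul c F hF =>
    obtain ⟨x, hx, ex⟩ := hF
    refine ⟨algebraMap ℂ K c • x, smul_mem_imageLattice (A.algebraMap_mem c) hx, ?_⟩
    rw [smul_comm, ← ex]
    simp only [map_smul, smul_add]
    have hc : ∀ y : SuperPoly (CliffordAlgebra.evenOdd (cliffForm r s h)),
        c • y = algebraMap ℂ K c • y := fun y => (algebraMap_smul K c y).symm
    rw [hc, hc, map_smul, smul_comm h]
  | hmul j α hα F hF =>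
    obtain ⟨x, hx, ex⟩ := hF
    obtain ⟨y, hy, ey⟩ := exists_dualAct_add_eq hA hf hα
    refine ⟨y * quantizePoly r s h F +
      ((-1 : ℤˣ) ^ (i * j)) • (quantizePoly r s h (coordFn _ α) * x),
      add_mem (mul_quantizePoly_mem_imageLattice hy F)
        (units_smul_mem_imageLattice _ (quantizePoly_mul_mem_imageLattice hx _)), ?_⟩
    rw [smul_add, smul_comm (h ^ 2) ((-1 : ℤˣ) ^ (i * j)), ← smul_mul_assoc, ← mul_smul_comm, ← ex,
      ← ey, map_mul, quantizePoly_coordFn, superDer_coordFn_mul _ _ _ _ (quantizeDual_mem r s h hα),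
      superDer_coordFn_mul _ _ _ _ hα, superDer_coordFn, superDer_coordFn, map_add, map_mul,
      Units.smul_def, Units.smul_def, map_zsmul, map_mul, quantizePoly_coordFn, quantizePoly_coordFn]
    simp only [add_mul, mul_add, smul_add, smul_mul_assoc, mul_smul_comm, Units.smul_def,
      smul_comm h (_ : ℤ)]
    abel

/-- Comparison of lowest-order terms: if `F` is `c Q(P)` up to higher-order terms, with coefficients
in `O`, and `l` is a functional on `K` that reads off the coefficient of the order of `c h`, then
every element of the Poisson superalgebra whose quantization annihilates `F` annihilates `P`. -/
theorem superDer_poisson_eq_zero (hA : h ∈ A) {i : ZMod 2} {f : Grassmann r s ℂ}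
    (hf : f ∈ CliffordAlgebra.evenOdd 0 i) (l : K →ₗ[ℂ] ℂ) (O : Set K) (c : K)
    (hc : l (c * h) = 1) (hcA : ∀ a ∈ A, l (c * h ^ 2 * a) = 0)
    (hO : ∀ d ∈ O, ∀ a ∈ A, l (d * h * a) = 0)
    {F : SuperPoly (CliffordAlgebra.evenOdd (cliffForm r s h))} {P : PoPoly r s}
    (hF : superDer (CliffordAlgebra.evenOdd (cliffForm r s h)) i
      (superCommutator (CliffordAlgebra.evenOdd (cliffForm r s h)) (quantize r s h f))
      (fun j => superCommutator_mem _ i j _ (quantize_mem r s h hf)) F = 0)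
    (hFP : F - c • quantizePoly r s h P ∈
      AddSubgroup.closure {H | ∃ d, ∃ G : PoPoly r s, d ∈ O ∧ H = d • quantizePoly r s h G}) :
    superDer (CliffordAlgebra.evenOdd 0) i (poissonBracket r s ℂ f)
      (fun j => poissonBracket_mem r s ℂ i j f hf) P = 0 := by
  have key : ∀ (d : K) (G : PoPoly r s), (∀ a ∈ A, l (d * h ^ 2 * a) = 0) →
      coeffPoly l (superDer (CliffordAlgebra.evenOdd (cliffForm r s h)) i
        (superCommutator (CliffordAlgebra.evenOdd (cliffForm r s h)) (quantize r s h f))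
        (fun j => superCommutator_mem _ i j _ (quantize_mem r s h hf))
        (d • quantizePoly r s h G)) =
      -(l (d * h) • superDer (CliffordAlgebra.evenOdd 0) i (poissonBracket r s ℂ f)
        (fun j => poissonBracket_mem r s ℂ i j f hf) G) := by
    intro d G hd
    obtain ⟨y, hy, ey⟩ := exists_superDer_quantizePoly_add_eq hA hf G
    rw [map_smul, eq_sub_of_add_eq ey, smul_sub, smul_smul, smul_smul, sub_eq_add_neg,
      coeffPoly_add, coeffPoly_neg, coeffPoly_smul_quantizePoly, coeffPoly_smul_eq_zero l hd hy,
      zero_add]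
  have hrem : ∀ H ∈ AddSubgroup.closure {H | ∃ d, ∃ G : PoPoly r s,
      d ∈ O ∧ H = d • quantizePoly r s h G},
      coeffPoly l (superDer (CliffordAlgebra.evenOdd (cliffForm r s h)) i
        (superCommutator (CliffordAlgebra.evenOdd (cliffForm r s h)) (quantize r s h f))
        (fun j => superCommutator_mem _ i j _ (quantize_mem r s h hf)) H) = 0 := by
    intro H hH
    induction hH using AddSubgroup.closure_induction with
    | mem x hx =>
      obtain ⟨d, G, hd, rfl⟩ := hx
      have h1 := hO d hd 1 (one_mem A)
      rw [mul_one] at h1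
      rw [key d G fun a ha => by
        rw [pow_two, ← mul_assoc, mul_assoc]; exact hO d hd _ (mul_mem hA ha), h1, zero_smul,
        neg_zero]
    | zero => rw [map_zero, coeffPoly_zero]
    | add x y _ _ hx hy => rw [map_add, coeffPoly_add, hx, hy, add_zero]
    | neg x _ hx => rw [map_neg, coeffPoly_neg, hx, neg_zero]
  have e := hrem _ hFP
  rw [map_sub, hF, zero_sub, coeffPoly_neg, key c P hcA, hc, one_smul, neg_neg] at e
  exact e

end Polynomials

/-! ### Laurent series -/

/-- An additive functional on a `ℂ`-algebra that is compatible with multiplication by constants, as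
a linear functional. The hypothesis is stated with `algebraMap` because `ℂ((t))` carries two scalar
multiplications by `ℂ`, which agree only propositionally. -/
def functionalOfAddMonoidHom {K : Type*} [Field K] [Algebra ℂ K] (l : K →+ ℂ)
    (hl : ∀ z c, l (algebraMap ℂ K z * c) = z * l c) : K →ₗ[ℂ] ℂ where
  toFun := l
  map_add' := map_add l
  map_smul' z c := by rw [Algebra.smul_def, hl]; rfl

/-- A product of Laurent series that are `O(t ^ N)` and `O(t ^ M)` is `O(t ^ (N + M))`. -/
theorem coeff_mul_eq_zero {N M : ℤ} {c d : LaurentSeries ℂ} (hc : ∀ k < N, c.coeff k = 0)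
    (hd : ∀ k < M, d.coeff k = 0) : ∀ k < N + M, (c * d).coeff k = 0 := by
  intro k hk
  rw [HahnSeries.coeff_mul]
  refine Finset.sum_eq_zero fun ij hij => ?_
  have hij := (Finset.mem_antidiagonal.1 hij).2.2
  by_cases h : ij.1 < N
  · rw [hc _ h, zero_mul]
  · rw [hd _ (by lia), mul_zero]

theorem coeff_tPow_of_lt (N : ℤ) : ∀ k < N, (tPow N).coeff k = 0 := fun _ hk =>
  HahnSeries.coeff_single_of_ne hk.ne

/-- The `ℂ`-algebra structure of `ℂ((t))`, inherited from `ℂ[[t]]`, is that of the constant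
series. -/
theorem algebraMap_laurentSeries (z : ℂ) :
    algebraMap ℂ (LaurentSeries ℂ) z = HahnSeries.single 0 z := by
  rw [HahnSeries.algebraMap_apply', PowerSeries.algebraMap_apply, HahnSeries.ofPowerSeries_C]
  rfl

theorem coeff_algebraMap_mul (z : ℂ) (c : LaurentSeries ℂ) (k : ℤ) :
    (algebraMap ℂ (LaurentSeries ℂ) z * c).coeff k = z * c.coeff k := by
  rw [algebraMap_laurentSeries, HahnSeries.coeff_single_zero_mul]

/-- The subalgebra `ℂ[[t]]` of `ℂ((t))`. -/
def regularSeries : Subalgebra ℂ (LaurentSeries ℂ) where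
  carrier := {c | ∀ k < 0, c.coeff k = 0}
  mul_mem' := fun hc hd => coeff_mul_eq_zero (N := 0) (M := 0) hc hd
  add_mem' := fun hc hd k hk => by simp [hc k hk, hd k hk]
  algebraMap_mem' := fun z k hk => by
    rw [algebraMap_laurentSeries]
    exact HahnSeries.coeff_single_of_ne hk.ne

/-- The superspaces have `m = 2r + s` odd generators, with `m = 2n` or `m = 2n - 1`. -/
theorem lemma5 (n r s : ℕ) (hm : (r = n ∧ s = 0) ∨ (r + 1 = n ∧ s = 1))
    (e : ℕ) (he : 1 ≤ e)
    (F : CliffPoly r s e) (hF : IsCliffInvariant r s e F)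
    (k₀ : ℤ) (Fk : ℤ → CliffPoly r s e) (hexp : HasExpansion r s e F k₀ Fk)
    (P : PoPoly r s) (hP : quantizePoly r s (hbar e) P = Fk k₀) :
    IsPoInvariant r s P := by
  intro i f hf
  have hsub := hexp.sub_mem (k₀ + 1)
  -- Only the first term of the expansion is split off; the remainder is `O(t ^ (k₀ + 1))`.
  have hIco : Finset.Ico k₀ (k₀ + 1) = {k₀} := by ext; simp; lia
  rw [hIco, Finset.sum_singleton, ← hP] at hsub
  refine superDer_poisson_eq_zero (A := regularSeries) (h := hbar e) ?_ hf
    (functionalOfAddMonoidHom (HahnSeries.coeff.addMonoidHom (k₀ + e))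
      fun z c => coeff_algebraMap_mul z c (k₀ + e)) {c | ∀ k < k₀ + 1, c.coeff k = 0} (tPow k₀)
    ?_ ?_ ?_ (hF i (quantize r s (hbar e) f) (quantize_mem r s _ hf)) hsub
  · exact fun k hk => coeff_tPow_of_lt e k (by lia)
  · change (tPow k₀ * tPow e).coeff (k₀ + e) = 1
    rw [tPow, tPow, HahnSeries.single_mul_single, mul_one, HahnSeries.coeff_single_same]
  -- The `ħ²`-terms have order at least `k₀ + 2e`, which exceeds `k₀ + e` because `1 ≤ e`.
  · intro a ha
    have h1 := coeff_mul_eq_zero (coeff_mul_eq_zero (coeff_tPow_of_lt k₀)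
      (coeff_mul_eq_zero (coeff_tPow_of_lt e) (coeff_tPow_of_lt e))) ha (k₀ + e) (by lia)
    rw [← pow_two] at h1
    exact h1
  · intro d hd a ha
    exact coeff_mul_eq_zero (coeff_mul_eq_zero hd (coeff_tPow_of_lt e)) ha (k₀ + e) (by lia)

end
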